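/- For $p\in[0,1]$ let $\mu_p$ be the Bernoulli measure on $2^\omega$, i.e. $\mu_p(\llbracket\sigma\rrbracket)=p^{\#_0(\sigma)}(1-p)^{\#_1(\sigma)}$ for every finite binary string $\sigma$, where $\#_i(\sigma)$ is the number of occurrences of $i$ in $\sigma$. Let $\mathsf{MLR}_{\mu_p}$ be the set of all $x\in 2^\omega$ that are Martin-Löf random with respect to $\mu_p$ relative to the oracle $p$ (given by its binary expansion): $x\notin\bigcap_i\mathcal U_i$ for every sequence $(\mathcal U_i)_{i\in\omega}$ of uniformly $\Sigma^{0,p}_1$ subsets of $2^\omega$ with $\mu_p(\mathcal U_i)\le 2^{-i}$ for all $i$. A sequence $x\in2^\omega$ is called proper if it is Martin-Löf random (with no oracle) with respect to some computable probability measure on $2^\omega$, and a real $p\in[0,1]$ is called proper if it is Martin-Löf random with respect to some computable probability measure on $[0,1]$, where a measure on $[0,1]$ is computable if the measures of finite unions of rational open intervals are uniformly lower semicomputable, and tests on $[0,1]$ are uniformly effective unions of rational open intervals. Corollary 3.6. For every $p\in[0,1]$ and every $x\in\mathsf{MLR}_{\mu_p}$, the sequence $x$ is proper if and only if $p$ is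 proper. -/

import Mathlib

namespace AlgRandom

open MeasureTheory

/-- A predicate is recursively enumerable relative to the oracles in `O` if it is the domain of a
partial function that is recursive in `O`. For `O = ∅` this is `REPred`. -/
def REPredIn {α : Type*} [Primcodable α] (O : Set (ℕ →. ℕ)) (P : α → Prop) : Prop :=
  RecursiveIn O fun a => Part.assert (P a) fun _ => Part.some ()

theorem rePredIn_empty_iff {α : Type*} [Primcodable α] (P : α → Prop) :
    REPredIn ∅ P ↔ REPred P :=
  recursiveIn_empty_iff

/-- `U` is a uniformly effectively open (`Σ⁰₁` relative to the oracles in `O`) sequence of subsets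
of `X`, with respect to the coded family `B` of basic open sets: for an r.e. set `W` of pairs,
`U i` is the union of all `B c` with `(i, c) ∈ W`. -/
def UniformlyEffectivelyOpen {X C : Type*} [Primcodable C] (B : C → Set X) (O : Set (ℕ →. ℕ))
    (U : ℕ → Set X) : Prop :=
  ∃ W : ℕ × C → Prop, REPredIn O W ∧ ∀ i, U i = {t | ∃ c, W (i, c) ∧ t ∈ B c}

/-- A Martin-Löf test for `μ`, relative to the oracles in `O`. -/
def IsMLTest {X C : Type*} [MeasurableSpace X] [Primcodable C] (B : C → Set X)
    (O : Set (ℕ →. ℕ)) (μ : Measure X) (U : ℕ → Set X) : Prop :=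
  UniformlyEffectivelyOpen B O U ∧ ∀ i, μ (U i) ≤ (2⁻¹ : ENNReal) ^ i

/-- The Martin-Löf random points for `μ` relative to the oracles in `O`: those that pass every
Martin-Löf test. -/
def MLR {X C : Type*} [MeasurableSpace X] [Primcodable C] (B : C → Set X)
    (O : Set (ℕ →. ℕ)) (μ : Measure X) : Set X :=
  {t | ∀ U : ℕ → Set X, IsMLTest B O μ U → t ∉ ⋂ i, U i}

/-! ### Cantor space; `false` is the symbol 0 and `true` is the symbol 1 -/

/-- The basic clopen set of all infinite sequences that extend the string `σ`. -/
def basicClopen (σ : List Bool) : Set (ℕ → Bool) :=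
  {x | ∀ (i : ℕ) (h : i < σ.length), x i = σ[i]}

/-- A measure on Cantor space is computable if `μ ⟦σ⟧` is a computable real uniformly in `σ`:
a computable function gives, on input `σ` and `n`, the numerator of a dyadic rational
with denominator `2 ^ n` within `2 ^ (-n)` of `μ ⟦σ⟧`. -/
def IsComputableMeasure (μ : Measure (ℕ → Bool)) : Prop :=
  ∃ f : List Bool → ℕ → ℕ, Computable₂ f ∧
    ∀ σ n, |μ.real (basicClopen σ) - (f σ n : ℝ) / 2 ^ n| ≤ 1 / 2 ^ n

/-- A sequence is proper if it is Martin-Löf random for some computable probability measure. -/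
def IsProperSeq (x : ℕ → Bool) : Prop :=
  ∃ μ : Measure (ℕ → Bool), IsProbabilityMeasure μ ∧ IsComputableMeasure μ ∧
    x ∈ MLR basicClopen ∅ μ

/-! ### The unit interval as a computable metric space -/

/-- The rational ball in `[0,1]` coded by `(a, r, d)`: centre `a / (d+1)`, radius `r / (d+1)`.
Every rational open interval of `[0,1]` is of this form. -/
def ratBall (c : ℕ × ℕ × ℕ) : Set unitInterval :=
  {t | |(t : ℝ) - (c.1 : ℝ) / ((c.2.2 : ℝ) + 1)| < (c.2.1 : ℝ) / ((c.2.2 : ℝ) + 1)}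

/-- A measure on `[0,1]` is computable if the measures of finite unions of rational balls are
uniformly lower semicomputable: the set of all `(L, (k, m))` with
`k / (m+1) < ν (⋃ c ∈ L, ratBall c)` is recursively enumerable. -/
def IsComputableMeasureUnit (ν : Measure unitInterval) : Prop :=
  REPred fun q : List (ℕ × ℕ × ℕ) × (ℕ × ℕ) =>
    (q.2.1 : ℝ) / ((q.2.2 : ℝ) + 1) < ν.real {t | ∃ c ∈ q.1, t ∈ ratBall c}

/-- A real in `[0,1]` is proper if it is Martin-Löf random for some computable probability measure
on `[0,1]`. -/
def IsProperReal (p : unitInterval) : Prop :=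
  ∃ ν : Measure unitInterval, IsProbabilityMeasure ν ∧ IsComputableMeasureUnit ν ∧
    p ∈ MLR ratBall ∅ ν

/-! ### Bernoulli randomness -/

/-- The Bernoulli measure `μ_p`: the coordinates are independent, and each is the symbol 0 with
probability `p` and the symbol 1 with probability `1 - p`. -/
noncomputable def bernoulliMu (p : unitInterval) : Measure (ℕ → Bool) :=
  Measure.infinitePi fun _ => ProbabilityTheory.bernoulliMeasure false true p

/-- The binary expansion of `p` as an oracle. (For `p = 1` all digits are 0; this oracle is
computable, as is the other expansion.) -/
noncomputable def binaryExpansion (p : unitInterval) : ℕ →. ℕ :=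
  fun n => Part.some (⌊(p : ℝ) * 2 ^ (n + 1)⌋₊ % 2)

/-- The Bernoulli `p`-random sequences: those that pass every `μ_p`-test relative to `p`. -/
def bernoulliMLR (p : unitInterval) : Set (ℕ → Bool) :=
  MLR basicClopen {binaryExpansion p} (bernoulliMu p)

end AlgRandom

/-!
Suppose that `p` is random for a computable measure `ν` on `[0,1]`, and let `μ` be the mixture
`∫ μ_t dν(t)`, a computable measure on Cantor space. If `x` fails a `μ`-test `U`, then by Markov's
inequality the sets `{t | 2⁻ⁱ < μ_t(U (2i))}` form a `ν`-test. Since `p` passes it, almost all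
`U (2i)` have `μ_p`-measure at most `2⁻ⁱ`, and so `x` is not random for `μ_p`.

Conversely, the frequency of zeros in a `μ_p`-random `x` tends to `p`, and Chebyshev's inequality
makes the convergence along the sample sizes `8 ^ (k + 2)` effective up to a constant that depends
on `x`. For each value of this constant, ignoring the frequencies that jump too far from their
predecessors gives an effectively continuous map on the whole of Cantor space, and one of these maps
sends `x` to `p`. If `x` is random for a computable measure, then `p` is random for the pushforward
of that measure along this map.
-/

namespace AlgRandom

open MeasureTheory Filter Topology ProbabilityTheory

section RecursivelyEnumerable

variable {α β γ : Type*} [Primcodable α] [Primcodable β] [Primcodable γ]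

theorem exists_partrec_choice {R : α → γ → Prop} (hR : PrimrecRel R) :
    ∃ f : α →. γ, Partrec f ∧ (∀ a, (f a).Dom ↔ ∃ c, R a c) ∧ ∀ a, ∀ c ∈ f a, R a c := by
  classical
  let g : α → ℕ → Option γ := fun a n =>
    (Encodable.decode (α := γ) n).bind fun c => if R a c then some c else none
  have hg : Primrec₂ g :=
    Primrec.option_bind (Primrec.decode.comp Primrec.snd)
      (Primrec.ite (hR.comp (Primrec.fst.comp Primrec.fst) Primrec.snd)
        (Primrec.option_some.comp Primrec.snd) (Primrec.const none))
  have mem_g {a n c} (h : c ∈ g a n) : R a c := by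
    obtain ⟨c', -, hc'⟩ := Option.bind_eq_some_iff.1 h
    split_ifs at hc' with hR'
    exact Option.some.inj hc' ▸ hR'
  refine ⟨fun a => Nat.rfindOpt (g a), Partrec.rfindOpt hg.to_comp, fun a => ?_, fun a c hc => ?_⟩
  · rw [Nat.rfindOpt_dom]
    refine ⟨fun ⟨n, c, h⟩ => ⟨c, mem_g h⟩, fun ⟨c, h⟩ => ⟨Encodable.encode c, c, ?_⟩⟩
    simp [g, h]
  · obtain ⟨n, hn⟩ := Nat.rfindOpt_spec hc
    exact mem_g hn

theorem rePred_of_primrecRel {P : α → Prop} {R : α → γ → Prop} (hR : PrimrecRel R)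
    (h : ∀ a, P a ↔ ∃ c, R a c) : REPred P := by
  obtain ⟨f, hf, hdom, -⟩ := exists_partrec_choice hR
  exact hf.dom_re.of_eq fun a => (hdom a).trans (h a).symm

theorem exists_primrecRel_of_rePred {P : α → Prop} (hP : REPred P) :
    ∃ R : α → ℕ → Prop, PrimrecRel R ∧ ∀ a, P a ↔ ∃ n, R a n := by
  obtain ⟨c, hc⟩ := Nat.Partrec.Code.exists_code.1 hP
  have hdom (a : α) : P a ↔ (Nat.Partrec.Code.eval c (Encodable.encode a)).Dom := by
    simp [congrFun hc, Part.assert]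
  refine ⟨fun a n => (Nat.Partrec.Code.evaln n c (Encodable.encode a)).isSome = true, ?_,
    fun a => (hdom a).trans ⟨fun h => ?_, fun ⟨n, hn⟩ => ?_⟩⟩
  · exact (Primrec.eq.comp (Primrec.option_isSome.comp (Nat.Partrec.Code.primrec_evaln.comp
      ((Primrec.snd.pair (Primrec.const c)).pair (Primrec.encode.comp Primrec.fst))))
      (Primrec.const true)).primrecRel
  · obtain ⟨k, hk⟩ := Nat.Partrec.Code.evaln_complete.1 (Part.get_mem h)
    exact ⟨k, Option.isSome_iff_exists.2 ⟨_, hk⟩⟩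
  · obtain ⟨v, hv⟩ := Option.isSome_iff_exists.1 hn
    exact Part.dom_iff_mem.2 ⟨v, Nat.Partrec.Code.evaln_sound hv⟩

theorem rePred_of_primrecPred {P : α → Prop} (hP : PrimrecPred P) : REPred P :=
  hP.computablePred.to_re

theorem rePred_comp {P : β → Prop} (hP : REPred P) {f : α → β} (hf : Computable f) :
    REPred fun a => P (f a) :=
  Partrec.comp hP hf

theorem rePred_exists {P : α × β → Prop} (hP : REPred P) : REPred fun a => ∃ b, P (a, b) := by
  obtain ⟨R, hR, h⟩ := exists_primrecRel_of_rePred hP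
  refine rePred_of_primrecRel (R := fun a (c : β × ℕ) => R (a, c.1) c.2) ?_ (by simp [h])
  exact hR.comp (Primrec.fst.pair (Primrec.fst.comp Primrec.snd)) (Primrec.snd.comp Primrec.snd)

theorem rePred_and {P Q : α → Prop} (hP : REPred P) (hQ : REPred Q) :
    REPred fun a => P a ∧ Q a := by
  obtain ⟨R, hR, hPR⟩ := exists_primrecRel_of_rePred hP
  obtain ⟨S, hS, hQS⟩ := exists_primrecRel_of_rePred hQ
  refine rePred_of_primrecRel (R := fun a (c : ℕ × ℕ) => R a c.1 ∧ S a c.2) ?_ (by simp [hPR, hQS])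
  exact (PrimrecPred.and (hR.comp Primrec.fst (Primrec.fst.comp Primrec.snd))
    (hS.comp Primrec.fst (Primrec.snd.comp Primrec.snd))).primrecRel

theorem rePred_or {P Q : α → Prop} (hP : REPred P) (hQ : REPred Q) :
    REPred fun a => P a ∨ Q a := by
  obtain ⟨R, hR, hPR⟩ := exists_primrecRel_of_rePred hP
  obtain ⟨S, hS, hQS⟩ := exists_primrecRel_of_rePred hQ
  exact rePred_of_primrecRel (R := fun a (n : ℕ) => R a n ∨ S a n) (PrimrecPred.or hR hS)
    (by simp [hPR, hQS, exists_or])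

theorem forall_mem_list_exists_iff {β : Type*} {R : β → ℕ → Prop} {L : List β} :
    (∀ b ∈ L, ∃ n, R b n) ↔ ∃ N, ∀ b ∈ L, ∃ n < N, R b n := by
  refine ⟨fun H => ?_, fun ⟨N, H⟩ b hb => (H b hb).imp fun n hn => hn.2⟩
  choose! g hg using H
  exact ⟨(L.map g).sum + 1, fun b hb =>
    ⟨g b, Nat.lt_succ_of_le (List.single_le_sum (by simp) _ (List.mem_map_of_mem hb)), hg b hb⟩⟩

theorem rePred_forall_mem {P : α × β → Prop} (hP : REPred P) {f : α → List β}
    (hf : Computable f) : REPred fun a => ∀ b ∈ f a, P (a, b) := by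
  obtain ⟨R, hR, h⟩ := exists_primrecRel_of_rePred hP
  suffices REPred fun q : List β × α => ∀ b ∈ q.1, P (q.2, b) from
    rePred_comp this (hf.pair Computable.id)
  refine rePred_of_primrecRel (R := fun (q : List β × α) (N : ℕ) => ∀ b ∈ q.1, ∃ n < N,
    R (q.2, b) n) ?_ fun q => by
      simpa only [h] using forall_mem_list_exists_iff
  have hbounded : PrimrecRel fun (N : ℕ) (q : α × β) => ∃ n < N, R q n :=
    (hR.swap.exists_mem_list.comp (Primrec.list_range.comp Primrec.fst)
      Primrec.snd).primrecRel.of_eq fun N q => by simp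
  have hmem : PrimrecRel fun (b : β) (q : α × ℕ) => ∃ n < q.2, R (q.1, b) n :=
    hbounded.comp (Primrec.snd.comp Primrec.snd) ((Primrec.fst.comp Primrec.snd).pair Primrec.fst)
  exact hmem.forall_mem_list.comp (Primrec.fst.comp Primrec.fst)
    ((Primrec.snd.comp Primrec.fst).pair Primrec.snd)

theorem exists_computable_choice {P : α × β → Prop} (hP : REPred P)
    (h : ∀ a, ∃ b, P (a, b)) : ∃ f : α → β, Computable f ∧ ∀ a, P (a, f a) := by
  obtain ⟨R, hR, hPR⟩ := exists_primrecRel_of_rePred hP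
  have hR' : PrimrecRel fun (a : α) (c : β × ℕ) => R (a, c.1) c.2 :=
    hR.comp (Primrec.fst.pair (Primrec.fst.comp Primrec.snd)) (Primrec.snd.comp Primrec.snd)
  obtain ⟨f, hf, hdom, hmem⟩ := exists_partrec_choice hR'
  have hf_dom (a : α) : (f a).Dom := by
    obtain ⟨b, hb⟩ := h a
    obtain ⟨n, hn⟩ := (hPR _).1 hb
    exact (hdom a).2 ⟨(b, n), hn⟩
  refine ⟨fun a => ((f a).get (hf_dom a)).1,
    Computable.fst.comp (hf.of_eq_tot fun a => Part.get_mem _), fun a => ?_⟩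
  exact (hPR _).2 ⟨_, hmem a _ (Part.get_mem (hf_dom a))⟩

end RecursivelyEnumerable

section PrimitiveRecursive

variable {α β : Type*} [Primcodable α] [Primcodable β]

theorem primrec_nat_pow : Primrec₂ ((· ^ ·) : ℕ → ℕ → ℕ) :=
  Primrec₂.unpaired'.1 Nat.Primrec.pow

theorem primrec_list_count [DecidableEq α] : Primrec₂ fun (L : List α) (a : α) => L.count a :=
  (Primrec.list_length.comp (PrimrecRel.listFilter (R := fun b a : α => b = a)
    Primrec.eq)).to₂.of_eq fun L a => by
      simp [List.count, List.countP_eq_length_filter, beq_eq_decide]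

theorem primrecPred_nodup : PrimrecPred fun L : List α => L.Nodup := by
  classical
  have hcount : PrimrecRel fun (a : α) (L : List α) => L.count a ≤ 1 :=
    Primrec.nat_le.comp (primrec_list_count.comp Primrec.snd Primrec.fst) (Primrec.const 1)
  refine (hcount.forall_mem_list.comp Primrec.id Primrec.id).of_eq fun L => ?_
  exact (List.nodup_iff_count_le_one.trans ⟨fun h a _ => h a, fun h a =>
    (Nat.eq_zero_or_pos (L.count a)).elim (by lia) fun ha => h a (List.count_pos_iff.1 ha)⟩).symm

theorem primrecRel_isPrefix : PrimrecRel fun σ τ : List α => σ <+: τ :=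
  (Primrec.eq.comp Primrec.fst (Primrec.list_take.comp
    (Primrec.list_length.comp Primrec.fst) Primrec.snd)).primrecRel.of_eq
    fun _ _ => List.prefix_iff_eq_take.symm

theorem primrec_list_sum : Primrec (List.sum : List ℕ → ℕ) :=
  (Primrec.list_foldr (f := fun L : List ℕ => L) (g := fun _ => 0) (h := fun _ q => q.1 + q.2)
    Primrec.id (Primrec.const 0) (Primrec.nat_add.comp (Primrec.fst.comp Primrec.snd)
      (Primrec.snd.comp Primrec.snd))).of_eq fun _ => List.sum_eq_foldr.symm

/-- A family of rationals, viewed as reals, is primitive recursive if it can be written as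
`(u - v) / w` for primitive recursive sequences of natural numbers `u`, `v` and `w > 0`. -/
def IsPrimrecRat (f : α → ℝ) : Prop :=
  ∃ u v w : α → ℕ, Primrec u ∧ Primrec v ∧ Primrec w ∧
    ∀ a, 0 < w a ∧ f a = ((u a : ℝ) - v a) / w a

namespace IsPrimrecRat

variable {f g : α → ℝ}

theorem natCast_div {u w : α → ℕ} (hu : Primrec u) (hw : Primrec w) (hpos : ∀ a, 0 < w a) :
    IsPrimrecRat fun a => (u a : ℝ) / w a :=
  ⟨u, fun _ => 0, w, hu, Primrec.const 0, hw, fun a => ⟨hpos a, by simp⟩⟩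

theorem comp (hf : IsPrimrecRat f) {h : β → α} (hh : Primrec h) :
    IsPrimrecRat fun b => f (h b) := by
  obtain ⟨u, v, w, hu, hv, hw, hf⟩ := hf
  exact ⟨_, _, _, hu.comp hh, hv.comp hh, hw.comp hh, fun b => hf (h b)⟩

theorem sub (hf : IsPrimrecRat f) (hg : IsPrimrecRat g) : IsPrimrecRat fun a => f a - g a := by
  obtain ⟨u, v, w, hu, hv, hw, hf⟩ := hf
  obtain ⟨u', v', w', hu', hv', hw', hg⟩ := hg
  have add_mul {s t s' t' : α → ℕ} (hs : Primrec s) (ht : Primrec t) (hs' : Primrec s')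
      (ht' : Primrec t') : Primrec fun a => s a * t a + s' a * t' a :=
    Primrec.nat_add.comp (Primrec.nat_mul.comp hs ht) (Primrec.nat_mul.comp hs' ht')
  refine ⟨_, _, _, add_mul hu hw' hv' hw, add_mul hv hw' hu' hw, Primrec.nat_mul.comp hw hw',
    fun a => ⟨Nat.mul_pos (hf a).1 (hg a).1, ?_⟩⟩
  have hw0 : (w a : ℝ) ≠ 0 := by exact_mod_cast (hf a).1.ne'
  have hw0' : (w' a : ℝ) ≠ 0 := by exact_mod_cast (hg a).1.ne'
  simp only [(hf a).2, (hg a).2]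
  push_cast
  field_simp
  ring

theorem abs (hf : IsPrimrecRat f) : IsPrimrecRat fun a => |f a| := by
  obtain ⟨u, v, w, hu, hv, hw, hf⟩ := hf
  refine ⟨fun a => max (u a) (v a), fun a => min (u a) (v a), w, Primrec.nat_max.comp hu hv,
    Primrec.nat_min.comp hu hv, hw, fun a => ⟨(hf a).1, ?_⟩⟩
  change |f a| = ((max (u a) (v a) : ℕ) - (min (u a) (v a) : ℕ)) / (w a : ℝ)
  rw [(hf a).2, abs_div, Nat.abs_cast, Nat.cast_max, Nat.cast_min, max_sub_min_eq_abs']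

theorem pos (hf : IsPrimrecRat f) : PrimrecPred fun a => 0 < f a := by
  obtain ⟨u, v, w, hu, hv, -, hf⟩ := hf
  refine (Primrec.nat_lt.comp hv hu : PrimrecPred fun a => v a < u a).of_eq fun a => ?_
  rw [(hf a).2, div_pos_iff_of_pos_right (by exact_mod_cast (hf a).1), sub_pos, Nat.cast_lt]

theorem lt (hf : IsPrimrecRat f) (hg : IsPrimrecRat g) : PrimrecPred fun a => f a < g a :=
  (hg.sub hf).pos.of_eq fun _ => sub_pos

theorem le (hf : IsPrimrecRat f) (hg : IsPrimrecRat g) : PrimrecPred fun a => f a ≤ g a :=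
  (hg.lt hf).not.of_eq fun _ => not_lt

end IsPrimrecRat

end PrimitiveRecursive

-- Otherwise unification unfolds `REPred` before it compares the predicates.
attribute [local irreducible] REPred

section GridBelow

/-- The largest `k` for which the grid point `k / d` lies strictly below `t`, or `0` if there is
none. -/
noncomputable def gridBelow (t : ℝ) (d : ℕ) : ℕ := ⌈t * d⌉₊ - 1

theorem le_gridBelow_iff {t : ℝ} {k d : ℕ} (hd : 0 < d) :
    k ≤ gridBelow t d ↔ k = 0 ∨ (k : ℝ) / d < t := by
  rw [div_lt_iff₀ (by exact_mod_cast hd), ← Nat.lt_ceil, gridBelow]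
  lia

theorem gridBelow_div_le {t : ℝ} (ht : 0 ≤ t) (d : ℕ) : (gridBelow t d : ℝ) / d ≤ t := by
  rcases d.eq_zero_or_pos with rfl | hd
  · simpa using ht
  · rcases (le_gridBelow_iff hd).1 (le_refl (gridBelow t d)) with h | h
    · simpa [h] using ht
    · exact h.le

theorem le_gridBelow_add_one_div (t : ℝ) {d : ℕ} (hd : 0 < d) :
    t ≤ ((gridBelow t d : ℝ) + 1) / d := by
  have hceil : (⌈t * d⌉₊ : ℝ) ≤ gridBelow t d + 1 := by
    rw [gridBelow]
    norm_cast
    lia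
  rw [le_div_iff₀ (by exact_mod_cast hd)]
  exact (Nat.le_ceil _).trans hceil

theorem tendsto_div_succ_of_abs_sub_le {u : ℕ → ℝ} {a C : ℝ}
    (h : ∀ n : ℕ, |u n - a * ((n : ℝ) + 1)| ≤ C) :
    Tendsto (fun n => u n / ((n : ℝ) + 1)) atTop (𝓝 a) := by
  have hC : Tendsto (fun n : ℕ => C * (1 / ((n : ℝ) + 1))) atTop (𝓝 0) := by
    simpa using tendsto_one_div_add_atTop_nhds_zero_nat.const_mul C
  refine tendsto_iff_norm_sub_tendsto_zero.2
    (squeeze_zero (fun _ => norm_nonneg _) (fun n => ?_) hC)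
  have hn : (0 : ℝ) < (n : ℝ) + 1 := by positivity
  rw [Real.norm_eq_abs, div_sub' hn.ne', abs_div, abs_of_pos hn, mul_comm _ a, mul_one_div]
  exact div_le_div_of_nonneg_right (h n) hn.le

theorem tendsto_gridBelow_div {t : ℝ} (ht : 0 ≤ t) :
    Tendsto (fun n : ℕ => (gridBelow t (n + 1) : ℝ) / (n + 1)) atTop (𝓝 t) := by
  refine tendsto_div_succ_of_abs_sub_le (C := 1) fun n => ?_
  have hle := gridBelow_div_le ht (n + 1)
  have hge := le_gridBelow_add_one_div t n.succ_pos
  rw [div_le_iff₀ (by positivity)] at hle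
  rw [le_div_iff₀ (by positivity)] at hge
  push_cast at hle hge
  exact abs_le.2 ⟨by linarith, by linarith⟩

end GridBelow

section LowerSemicomputable

variable {α β : Type*} [Primcodable α] [Primcodable β]

/-- A real-valued function is lower semicomputable if the nonnegative rationals below its values
are uniformly recursively enumerable; this determines the function when it is nonnegative. -/
def LowerSemicomputable (F : α → ℝ) : Prop :=
  REPred fun q : α × ℕ × ℕ => (q.2.1 : ℝ) / ((q.2.2 : ℝ) + 1) < F q.1

namespace LowerSemicomputable

variable {F : α → ℝ}

theorem comp (hF : LowerSemicomputable F) {g : β → α} (hg : Computable g) :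
    LowerSemicomputable fun b => F (g b) :=
  rePred_comp hF ((hg.comp Computable.fst).pair Computable.snd)

theorem of_lt_iff {P : α × β → Prop} (hP : REPred P) {G : α × β → ℝ}
    (hG : LowerSemicomputable G)
    (h : ∀ a (r : ℝ), 0 ≤ r → (r < F a ↔ ∃ b, P (a, b) ∧ r < G (a, b))) :
    LowerSemicomputable F := by
  have hpair : Computable fun q : (α × ℕ × ℕ) × β => (q.1.1, q.2) :=
    (Computable.fst.comp Computable.fst).pair Computable.snd
  have hPG := rePred_and (rePred_comp hP hpair)
    (rePred_comp hG (hpair.pair (Computable.snd.comp Computable.fst)))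
  exact (rePred_exists hPG).of_eq fun q => (h q.1 (q.2.1 / (q.2.2 + 1)) (by positivity)).symm

theorem of_tendsto {G : α × ℕ → ℝ} (hG : LowerSemicomputable G) (hle : ∀ a n, G (a, n) ≤ F a)
    (hlim : ∀ a, Tendsto (fun n => G (a, n)) atTop (𝓝 (F a))) : LowerSemicomputable F := by
  refine of_lt_iff (P := fun _ => True) (rePred_of_primrecPred (Primrec.const true).primrecPred)
    hG fun a r _ => ?_
  simp only [true_and]
  exact ⟨fun hr => ((hlim a).eventually (lt_mem_nhds hr)).exists,
    fun ⟨n, hn⟩ => hn.trans_le (hle a n)⟩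

theorem natCast {f : α → ℕ} (hf : Computable f) : LowerSemicomputable fun a => (f a : ℝ) := by
  have hlt : PrimrecPred fun q : ℕ × ℕ × ℕ => q.2.1 < q.1 * (q.2.2 + 1) :=
    Primrec.nat_lt.comp (Primrec.fst.comp Primrec.snd)
      (Primrec.nat_mul.comp Primrec.fst (Primrec.succ.comp (Primrec.snd.comp Primrec.snd)))
  have hcast : LowerSemicomputable fun n : ℕ => (n : ℝ) :=
    (rePred_of_primrecPred hlt).of_eq fun q => by
      rw [div_lt_iff₀ (by positivity)]
      dsimp only
      norm_cast
  exact hcast.comp hf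

theorem div_natCast (hF : LowerSemicomputable F) {d : α → ℕ} (hd : Computable d)
    (hpos : ∀ a, 0 < d a) : LowerSemicomputable fun a => F a / d a := by
  have hmul : Computable fun q : α × ℕ × ℕ => q.2.1 * d q.1 :=
    Primrec.nat_mul.to_comp.comp (Computable.fst.comp Computable.snd) (hd.comp Computable.fst)
  refine (rePred_comp hF (Computable.fst.pair
    (hmul.pair (Computable.snd.comp Computable.snd)))).of_eq fun q => ?_
  rw [lt_div_iff₀ (by exact_mod_cast hpos q.1), Nat.cast_mul, div_mul_eq_mul_div]

theorem rePred_le_gridBelow (hF : LowerSemicomputable F) {k d : α → ℕ} (hk : Computable k)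
    (hd : Computable d) (hpos : ∀ a, 0 < d a) : REPred fun a => k a ≤ gridBelow (F a) (d a) := by
  have hzero : REPred fun a => k a = 0 :=
    rePred_comp (rePred_of_primrecPred (Primrec.eq.comp Primrec.id (Primrec.const 0))) hk
  have hlt : REPred fun a => (k a : ℝ) / d a < F a :=
    (rePred_comp hF (Computable.id.pair (hk.pair (Computable.pred.comp hd)))).of_eq fun a => by
      simp [Nat.cast_pred (hpos a)]
  exact (rePred_or hzero hlt).of_eq fun a => (le_gridBelow_iff (hpos a)).symm

theorem exists_computable_approx (hF : LowerSemicomputable F)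
    (hF' : LowerSemicomputable fun a => 1 - F a) (h0 : ∀ a, 0 ≤ F a) (h1 : ∀ a, F a ≤ 1) :
    ∃ f : α → ℕ → ℕ, Computable₂ f ∧ ∀ a n, |F a - (f a n : ℝ) / 2 ^ n| ≤ 1 / 2 ^ n := by
  have hpow : Computable fun q : (α × ℕ) × ℕ => 2 ^ q.1.2 :=
    primrec_nat_pow.to_comp.comp (Computable.const 2) (Computable.snd.comp Computable.fst)
  have hfst : Computable fun q : (α × ℕ) × ℕ => q.1.1 := Computable.fst.comp Computable.fst
  have happrox : REPred fun q : (α × ℕ) × ℕ => q.2 - 1 ≤ gridBelow (F q.1.1) (2 ^ q.1.2) ∧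
      2 ^ q.1.2 - (q.2 + 1) ≤ gridBelow (1 - F q.1.1) (2 ^ q.1.2) :=
    rePred_and
      ((hF.comp hfst).rePred_le_gridBelow (Computable.pred.comp Computable.snd) hpow
        fun _ => by positivity)
      ((hF'.comp hfst).rePred_le_gridBelow (Primrec.nat_sub.to_comp.comp hpow
        (Computable.succ.comp Computable.snd)) hpow fun _ => by positivity)
  obtain ⟨f, hf, hspec⟩ := exists_computable_choice happrox fun ⟨a, n⟩ => by
    refine ⟨gridBelow (F a) (2 ^ n) + 1, by simp, ?_⟩
    rw [le_gridBelow_iff (by positivity), or_iff_not_imp_left]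
    intro hne
    have := le_gridBelow_add_one_div (F a) (d := 2 ^ n) (by positivity)
    rw [le_div_iff₀ (by positivity)] at this
    rw [div_lt_iff₀ (by positivity), Nat.cast_sub (by lia)]
    push_cast at this ⊢
    linarith
  refine ⟨fun a n => f (a, n), hf, fun a n => ?_⟩
  have hlow := (div_le_div_of_nonneg_right (Nat.cast_le.2 (hspec (a, n)).1) (by positivity)).trans
    (gridBelow_div_le (h0 a) (2 ^ n))
  have hup := (div_le_div_of_nonneg_right (Nat.cast_le.2 (hspec (a, n)).2) (by positivity)).trans
    (gridBelow_div_le (sub_nonneg.2 (h1 a)) (2 ^ n))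
  rw [div_le_iff₀ (by positivity)] at hlow hup
  have hpred : (f (a, n) : ℝ) ≤ ((f (a, n) - 1 : ℕ) : ℝ) + 1 := by norm_cast; lia
  have hsub : (2 ^ n : ℝ) ≤ ((2 ^ n - (f (a, n) + 1) : ℕ) : ℝ) + (f (a, n) + 1) := by
    norm_cast; lia
  rw [sub_div' (by positivity), abs_div, abs_of_pos (a := (2 : ℝ) ^ n) (by positivity)]
  refine div_le_div_of_nonneg_right ?_ (by positivity)
  push_cast at hlow hup
  exact abs_le.2 ⟨by linarith, by linarith⟩

theorem of_computable_approx {f : α → ℕ → ℕ} (hf : Computable₂ f)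
    (h : ∀ a n, |F a - (f a n : ℝ) / 2 ^ n| ≤ 1 / 2 ^ n) (h0 : ∀ a, 0 ≤ F a) :
    LowerSemicomputable F := by
  have happrox : LowerSemicomputable fun q : α × ℕ =>
      ((f q.1 q.2 - 1 : ℕ) : ℝ) / ((2 ^ q.2 : ℕ) : ℝ) :=
    (natCast (Computable.pred.comp hf)).div_natCast
      (primrec_nat_pow.to_comp.comp (Computable.const 2) Computable.snd) fun _ => by positivity
  have hle (a : α) (n : ℕ) : ((f a n - 1 : ℕ) : ℝ) / 2 ^ n ≤ F a := by
    rcases Nat.eq_zero_or_pos (f a n) with hzero | hpos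
    · simpa [hzero] using h0 a
    · rw [Nat.cast_pred hpos, sub_div]
      linarith [(abs_le.1 (h a n)).1]
  have hge (a : α) (n : ℕ) : F a - 2 * (1 / 2) ^ n ≤ ((f a n - 1 : ℕ) : ℝ) / 2 ^ n := by
    have hpred : (f a n : ℝ) ≤ ((f a n - 1 : ℕ) : ℝ) + 1 := by norm_cast; lia
    have := div_le_div_of_nonneg_right hpred (c := (2 : ℝ) ^ n) (by positivity)
    rw [add_div] at this
    rw [one_div_pow]
    linarith [(abs_le.1 (h a n)).2]
  have hlim (a : α) : Tendsto (fun n => F a - 2 * (1 / 2 : ℝ) ^ n) atTop (𝓝 (F a)) := by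
    simpa using ((tendsto_pow_atTop_nhds_zero_of_lt_one (by norm_num)
      (by norm_num : (1 / 2 : ℝ) < 1)).const_mul 2).const_sub (F a)
  push_cast at happrox
  exact of_tendsto happrox hle fun a =>
    tendsto_of_tendsto_of_tendsto_of_le_of_le (hlim a) tendsto_const_nhds (hge a) (hle a)

theorem list_sum (hF : LowerSemicomputable F) (h0 : ∀ a, 0 ≤ F a) :
    LowerSemicomputable fun L : List α => (L.map F).sum := by
  have hP : REPred fun q : List α × ℕ × List (α × ℕ) =>
      q.1 = q.2.2.map Prod.fst ∧ ∀ b ∈ q.2.2, b.2 ≤ gridBelow (F b.1) (q.2.1 + 1) := by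
    refine rePred_and (rePred_of_primrecPred (Primrec.eq.comp Primrec.fst (Primrec.list_map
      (Primrec.snd.comp Primrec.snd) (Primrec.fst.comp Primrec.snd).to₂)))
      (rePred_forall_mem (P := fun q : (List α × ℕ × List (α × ℕ)) × (α × ℕ) =>
        q.2.2 ≤ gridBelow (F q.2.1) (q.1.2.1 + 1)) ?_ (Computable.snd.comp Computable.snd))
    exact (hF.comp (Computable.fst.comp Computable.snd)).rePred_le_gridBelow
      (Computable.snd.comp Computable.snd)
      (Computable.succ.comp (Computable.fst.comp (Computable.snd.comp Computable.fst)))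
      fun _ => Nat.succ_pos _
  have hsum (M : ℕ) (T : List (α × ℕ)) : ((T.map Prod.snd).sum : ℝ) / ((M + 1 : ℕ) : ℝ) =
      (T.map fun b => (b.2 : ℝ) / (M + 1)).sum := by
    simp [div_eq_mul_inv, List.sum_map_mul_right, Function.comp_def]
  have hG : LowerSemicomputable fun q : List α × ℕ × List (α × ℕ) =>
      (q.2.2.map fun b => (b.2 : ℝ) / (q.2.1 + 1)).sum := by
    simp only [← hsum]
    exact (natCast (primrec_list_sum.comp (Primrec.list_map (Primrec.snd.comp Primrec.snd)
      (Primrec.snd.comp Primrec.snd).to₂)).to_comp).div_natCast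
      (Computable.succ.comp (Computable.fst.comp Computable.snd)) fun _ => Nat.succ_pos _
  refine of_lt_iff hP hG fun L r _ => ⟨fun hr => ?_, ?_⟩
  · have hlim : Tendsto (fun M : ℕ => (L.map fun a =>
        (gridBelow (F a) (M + 1) : ℝ) / (M + 1)).sum) atTop (𝓝 (L.map F).sum) :=
      tendsto_list_sum _ fun a _ => tendsto_gridBelow_div (h0 a)
    obtain ⟨M, hM⟩ := (hlim.eventually (lt_mem_nhds hr)).exists
    exact ⟨(M, L.map fun a => (a, gridBelow (F a) (M + 1))),
      ⟨by simp [Function.comp_def], by simp⟩, by simpa [Function.comp_def] using hM⟩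
  · rintro ⟨⟨M, T⟩, ⟨hL, hT⟩, hr⟩
    refine hr.trans_le ?_
    simp only at hL hT
    rw [hL, List.map_map]
    refine List.sum_le_sum fun b hb => le_trans ?_ (gridBelow_div_le (h0 b.1) (M + 1))
    push_cast
    exact div_le_div_of_nonneg_right (Nat.cast_le.2 (hT b hb)) (by positivity)

end LowerSemicomputable

end LowerSemicomputable

section BasicUnion

variable {X C : Type*} {B : C → Set X}

/-- The open set enumerated by a set `P` of codes of basic open sets. -/
def basicUnion (B : C → Set X) (P : C → Prop) : Set X :=
  {t | ∃ c, P c ∧ t ∈ B c}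

theorem basicUnion_exists {ι : Sort*} (B : C → Set X) (P : ι → C → Prop) :
    basicUnion B (fun c => ∃ i, P i c) = ⋃ i, basicUnion B (P i) := by
  ext t
  simp only [basicUnion, Set.mem_ofPred_eq, Set.mem_iUnion]
  exact ⟨fun ⟨c, ⟨i, hi⟩, ht⟩ => ⟨i, c, hi, ht⟩, fun ⟨i, c, hi, ht⟩ => ⟨c, ⟨i, hi⟩, ht⟩⟩

variable [MeasurableSpace X]

theorem measurableSet_basicUnion [Countable C] (hB : ∀ c, MeasurableSet (B c)) (P : C → Prop) :
    MeasurableSet (basicUnion B P) := by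
  have : basicUnion B P = ⋃ (c) (_ : P c), B c := by ext; simp [basicUnion]
  rw [this]
  exact MeasurableSet.iUnion fun c => MeasurableSet.iUnion fun _ => hB c

theorem lt_measureReal_iUnion_iff_of_directed {ι : Type*} [Countable ι] {μ : Measure X}
    [IsFiniteMeasure μ] {s : ι → Set X} (hs : Directed (· ⊆ ·) s) {r : ℝ} (hr : 0 ≤ r) :
    r < μ.real (⋃ i, s i) ↔ ∃ i, r < μ.real (s i) := by
  simp_rw [measureReal_def, ← ENNReal.ofReal_lt_iff_lt_toReal hr (measure_ne_top μ _),
    hs.measure_iUnion, lt_iSup_iff]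

theorem LowerSemicomputable.measure_basicUnion {α : Type*} [Primcodable α] [Primcodable C]
    {μ : Measure X} [IsFiniteMeasure μ]
    (hμ : LowerSemicomputable fun L : List C => μ.real (basicUnion B (· ∈ L)))
    {W : α × C → Prop} (hW : REPred W) :
    LowerSemicomputable fun a => μ.real (basicUnion B fun c => W (a, c)) := by
  have hP : REPred fun q : α × List C => ∀ c ∈ q.2, W (q.1, c) :=
    rePred_forall_mem (P := fun q : (α × List C) × C => W (q.1.1, q.2))
      (rePred_comp hW ((Computable.fst.comp Computable.fst).pair Computable.snd)) Computable.snd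
  refine of_lt_iff hP (hμ.comp Computable.snd) fun a r hr => ?_
  have hunion : basicUnion B (fun c => W (a, c)) =
      ⋃ L : {L : List C // ∀ c ∈ L, W (a, c)}, basicUnion B (· ∈ L.1) := by
    rw [← basicUnion_exists]
    congr! 2 with c
    exact ⟨fun hc => ⟨⟨[c], by simpa using hc⟩, by simp⟩, fun ⟨L, hc⟩ => L.2 c hc⟩
  have hdir : Directed (· ⊆ ·)
      fun L : {L : List C // ∀ c ∈ L, W (a, c)} => basicUnion B (· ∈ L.1) := fun L L' =>
    ⟨⟨L.1 ++ L'.1, fun c hc => (List.mem_append.1 hc).elim (L.2 c) (L'.2 c)⟩,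
      fun _ ⟨c, hc, ht⟩ => ⟨c, List.mem_append_left _ hc, ht⟩,
      fun _ ⟨c, hc, ht⟩ => ⟨c, List.mem_append_right _ hc, ht⟩⟩
  rw [hunion, lt_measureReal_iUnion_iff_of_directed hdir hr, Subtype.exists]
  simp only [exists_prop]

end BasicUnion

section Randomness

variable {X C : Type*} [MeasurableSpace X] [Primcodable C] {B : C → Set X} {μ : Measure X} {t : X}

theorem MLR_subset_MLR_empty (O : Set (ℕ →. ℕ)) (μ : Measure X) : MLR B O μ ⊆ MLR B ∅ μ :=
  fun _ ht U ⟨⟨W, hW, hU⟩, hμ⟩ => ht U ⟨⟨W, RecursiveIn.mono (Set.empty_subset _) hW, hU⟩, hμ⟩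

theorem mem_MLR_empty_iff : t ∈ MLR B ∅ μ ↔ ∀ W : ℕ × C → Prop, REPred W →
    (∀ i, μ (basicUnion B fun c => W (i, c)) ≤ (2⁻¹ : ENNReal) ^ i) →
      ∃ i, t ∉ basicUnion B fun c => W (i, c) := by
  refine ⟨fun ht W hW hμ => ?_, fun h U ⟨⟨W, hW, hU⟩, hμ⟩ ht => ?_⟩
  · exact not_forall.1 (mt Set.mem_iInter.2
      (ht _ ⟨⟨W, (rePredIn_empty_iff W).2 hW, fun _ => rfl⟩, hμ⟩))
  · obtain rfl : U = fun i => basicUnion B fun c => W (i, c) := funext hU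
    obtain ⟨i, hi⟩ := h W ((rePredIn_empty_iff W).1 hW) hμ
    exact hi (Set.mem_iInter.1 ht i)

/-- An effective Borel–Cantelli lemma: the tails of the given sequence of sets form a test. -/
theorem eventually_notMem_of_mem_MLR (ht : t ∈ MLR B ∅ μ) {W : ℕ × C → Prop} (hW : REPred W)
    (hμ : ∀ᶠ i in atTop, μ (basicUnion B fun c => W (i, c)) ≤ (2⁻¹ : ENNReal) ^ i) :
    ∀ᶠ i in atTop, t ∉ basicUnion B fun c => W (i, c) := by
  obtain ⟨K, hK⟩ := eventually_atTop.1 hμ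
  have hindex : Computable fun q : (ℕ × C) × ℕ => q.1.1 + K + (q.2 + 1) :=
    Primrec.nat_add.to_comp.comp (Primrec.nat_add.to_comp.comp
      (Computable.fst.comp Computable.fst) (Computable.const K))
      (Computable.succ.comp Computable.snd)
  have htail : REPred fun q : ℕ × C => ∃ j, W (q.1 + K + (j + 1), q.2) :=
    rePred_exists (P := fun q : (ℕ × C) × ℕ => W (q.1.1 + K + (q.2 + 1), q.1.2))
      (rePred_comp hW (hindex.pair (Computable.snd.comp Computable.fst)))
  obtain ⟨N, hN⟩ := mem_MLR_empty_iff.1 ht _ htail fun N => by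
    rw [basicUnion_exists]
    calc μ (⋃ j, basicUnion B fun c => W (N + K + (j + 1), c))
        ≤ ∑' j, μ (basicUnion B fun c => W (N + K + (j + 1), c)) := measure_iUnion_le _
      _ ≤ ∑' j, (2⁻¹ : ENNReal) ^ (N + K) * (2⁻¹ : ENNReal) ^ (j + 1) :=
          ENNReal.tsum_le_tsum fun j => by simpa only [pow_add] using hK (N + K + (j + 1)) (by lia)
      _ = (2⁻¹ : ENNReal) ^ (N + K) := by
          rw [ENNReal.tsum_mul_left, ENNReal.tsum_geometric_add_one, ENNReal.one_sub_inv_two,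
            inv_inv, ENNReal.inv_mul_cancel (by simp) (by simp), mul_one]
      _ ≤ (2⁻¹ : ENNReal) ^ N := pow_le_pow_right_of_le_one' (by simp) (Nat.le_add_right N K)
  rw [basicUnion_exists, Set.mem_iUnion, not_exists] at hN
  filter_upwards [eventually_ge_atTop (N + K + 1)] with i hi
  convert hN (i - (N + K + 1)) using 6
  lia

end Randomness

section EffectivelyContinuous

variable {X C X' C' : Type*} [Primcodable C] [Primcodable C'] {B : C → Set X} {B' : C' → Set X'}
  {Φ : X → X'}

/-- A map is effectively continuous if the preimages of the basic open sets are uniformly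
effectively open. -/
def EffectivelyContinuous (B : C → Set X) (B' : C' → Set X') (Φ : X → X') : Prop :=
  ∃ V : C' × C → Prop, REPred V ∧ ∀ c', Φ ⁻¹' B' c' = basicUnion B fun c => V (c', c)

namespace EffectivelyContinuous

theorem exists_preimage_basicUnion_eq (hΦ : EffectivelyContinuous B B' Φ) {α : Type*}
    [Primcodable α] {W : α × C' → Prop} (hW : REPred W) :
    ∃ W' : α × C → Prop, REPred W' ∧
      ∀ a, Φ ⁻¹' basicUnion B' (fun c' => W (a, c')) = basicUnion B fun c => W' (a, c) := by
  obtain ⟨V, hV, hΦV⟩ := hΦ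
  have hWV : REPred fun q : (α × C) × C' => W (q.1.1, q.2) ∧ V (q.2, q.1.2) :=
    rePred_and (rePred_comp hW ((Computable.fst.comp Computable.fst).pair Computable.snd))
      (rePred_comp hV (Computable.snd.pair (Computable.snd.comp Computable.fst)))
  refine ⟨_, rePred_exists hWV, fun a => ?_⟩
  ext t
  have hV_iff (c' : C') : Φ t ∈ B' c' ↔ ∃ c, V (c', c) ∧ t ∈ B c := Set.ext_iff.1 (hΦV c') t
  simp only [basicUnion, Set.mem_preimage, Set.mem_ofPred_eq, hV_iff]
  grind

theorem mem_MLR_map [MeasurableSpace X] [MeasurableSpace X'] (hΦ : EffectivelyContinuous B B' Φ)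
    (hmeas : Measurable Φ) (hB' : ∀ c', MeasurableSet (B' c')) {μ : Measure X} {t : X}
    (ht : t ∈ MLR B ∅ μ) : Φ t ∈ MLR B' ∅ (μ.map Φ) := by
  refine mem_MLR_empty_iff.2 fun W hW hμ => ?_
  obtain ⟨W', hW', hpre⟩ := hΦ.exists_preimage_basicUnion_eq hW
  obtain ⟨i, hi⟩ := mem_MLR_empty_iff.1 ht W' hW' fun i => by
    rw [← hpre, ← Measure.map_apply hmeas (measurableSet_basicUnion hB' _)]
    exact hμ i
  exact ⟨i, fun h => hi (hpre i ▸ h)⟩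

end EffectivelyContinuous

end EffectivelyContinuous

section CantorSpace

/-- The string of the first `n` symbols of `x`. -/
def initialSegment (x : ℕ → Bool) (n : ℕ) : List Bool :=
  (List.range n).map x

@[simp]
theorem length_initialSegment (x : ℕ → Bool) (n : ℕ) : (initialSegment x n).length = n := by
  simp [initialSegment]

theorem take_initialSegment (x : ℕ → Bool) {m n : ℕ} (h : m ≤ n) :
    (initialSegment x n).take m = initialSegment x m := by
  rw [initialSegment, ← List.map_take, List.take_range, min_eq_left h, initialSegment]

theorem mem_basicClopen_iff {x : ℕ → Bool} {σ : List Bool} :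
    x ∈ basicClopen σ ↔ initialSegment x σ.length = σ := by
  refine ⟨fun h => List.ext_getElem (by simp) fun i _ hi => by simpa [initialSegment] using h i hi,
    fun h i hi => ?_⟩
  conv_rhs => rw [List.getElem_of_eq h.symm hi]
  simp [initialSegment]

theorem mem_basicClopen_iff_isPrefix {x : ℕ → Bool} {σ : List Bool} {n : ℕ} (h : σ.length ≤ n) :
    x ∈ basicClopen σ ↔ σ <+: initialSegment x n := by
  rw [mem_basicClopen_iff, List.prefix_iff_eq_take, take_initialSegment x h, eq_comm]

theorem basicClopen_subset_of_isPrefix {σ τ : List Bool} (h : σ <+: τ) :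
    basicClopen τ ⊆ basicClopen σ := fun x hx => by
  rwa [mem_basicClopen_iff_isPrefix h.length_le, mem_basicClopen_iff.1 hx]

theorem basicUnion_basicClopen_of_length (n : ℕ) (P : List Bool → Prop) :
    basicUnion basicClopen (fun σ => σ.length = n ∧ P σ) = {x | P (initialSegment x n)} := by
  ext x
  refine ⟨?_, fun h => ⟨initialSegment x n, ⟨by simp, h⟩, by simp [mem_basicClopen_iff]⟩⟩
  rintro ⟨σ, ⟨rfl, hσ⟩, hx⟩
  rwa [Set.mem_ofPred_eq, mem_basicClopen_iff.1 hx]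

theorem measurableSet_basicClopen (σ : List Bool) : MeasurableSet (basicClopen σ) := by
  simp only [basicClopen, Set.ofPred_forall]
  exact MeasurableSet.iInter fun i => MeasurableSet.iInter fun _ =>
    measurable_pi_apply i (measurableSet_singleton _)

theorem measurable_comp_initialSegment {Y : Type*} [MeasurableSpace Y] (f : List Bool → Y)
    (n : ℕ) : Measurable fun x => f (initialSegment x n) := fun s _ => by
  change MeasurableSet {x | f (initialSegment x n) ∈ s}
  rw [← basicUnion_basicClopen_of_length n (f · ∈ s)]
  exact measurableSet_basicUnion measurableSet_basicClopen _

/-- A list of distinct strings of one length, each of which extends a string in `W`. The cylinders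
of such strings are pairwise disjoint subsets of the open set enumerated by `W`. -/
def IsExtensionList (W : List Bool → Prop) (T : List (List Bool)) : Prop :=
  T.Nodup ∧ ∃ N, ∀ τ ∈ T, τ.length = N ∧ ∃ σ, W σ ∧ σ <+: τ

theorem rePred_isExtensionList {α : Type*} [Primcodable α] {W : α × List Bool → Prop}
    (hW : REPred W) :
    REPred fun q : α × List (List Bool) => IsExtensionList (fun σ => W (q.1, σ)) q.2 := by
  have hprefix : REPred fun q : (((α × List (List Bool)) × ℕ) × List Bool) × List Bool =>
      W (q.1.1.1.1, q.2) ∧ q.2 <+: q.1.2 :=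
    rePred_and
      (rePred_comp hW ((Computable.fst.comp (Computable.fst.comp (Computable.fst.comp
        Computable.fst))).pair Computable.snd))
      (rePred_of_primrecPred (primrecRel_isPrefix.comp Primrec.snd (Primrec.snd.comp Primrec.fst)))
  have hstring : REPred fun q : ((α × List (List Bool)) × ℕ) × List Bool =>
      q.2.length = q.1.2 ∧ ∃ σ, W (q.1.1.1, σ) ∧ σ <+: q.2 :=
    rePred_and (rePred_of_primrecPred (Primrec.eq.comp (Primrec.list_length.comp Primrec.snd)
      (Primrec.snd.comp Primrec.fst))) (rePred_exists hprefix)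
  exact rePred_and (rePred_of_primrecPred (primrecPred_nodup.comp Primrec.snd))
    (rePred_exists (rePred_forall_mem hstring (f := fun q => q.1.2)
      (Computable.snd.comp Computable.fst)))

namespace IsExtensionList

variable {W : List Bool → Prop} {T : List (List Bool)}

theorem basicUnion_subset (hT : IsExtensionList W T) :
    basicUnion basicClopen (· ∈ T) ⊆ basicUnion basicClopen W := by
  obtain ⟨-, N, hN⟩ := hT
  rintro x ⟨τ, hτ, hx⟩
  obtain ⟨-, σ, hσ, hprefix⟩ := hN τ hτ
  exact ⟨σ, hσ, basicClopen_subset_of_isPrefix hprefix hx⟩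

theorem sum_measureReal (hT : IsExtensionList W T) (μ : Measure (ℕ → Bool)) [IsFiniteMeasure μ] :
    (T.map fun τ => μ.real (basicClopen τ)).sum = μ.real (basicUnion basicClopen (· ∈ T)) := by
  obtain ⟨hnodup, N, hN⟩ := hT
  have hunion : basicUnion basicClopen (· ∈ T) = ⋃ τ ∈ T.toFinset, basicClopen τ := by
    ext x; simp [basicUnion]
  have hdisjoint : (T.toFinset : Set (List Bool)).PairwiseDisjoint basicClopen := by
    intro σ hσ τ hτ hne
    refine Set.disjoint_left.2 fun x hx hx' => hne ?_
    rw [mem_basicClopen_iff] at hx hx'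
    rw [← hx, ← hx', (hN σ (by simpa using hσ)).1, (hN τ (by simpa using hτ)).1]
  rw [hunion, measureReal_biUnion_finset hdisjoint fun τ _ => measurableSet_basicClopen τ,
    List.sum_toFinset _ hnodup]

end IsExtensionList

theorem exists_isExtensionList (W : List Bool → Prop) (N : ℕ) :
    ∃ T, IsExtensionList W T ∧
      basicUnion basicClopen (· ∈ T) = {x | ∃ σ, W σ ∧ σ <+: initialSegment x N} := by
  classical
  let T := (List.finite_length_eq Bool N).toFinset.filter fun τ => ∃ σ, W σ ∧ σ <+: τ
  have hT : ∀ τ, τ ∈ T.toList ↔ τ.length = N ∧ ∃ σ, W σ ∧ σ <+: τ := by simp [T]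
  refine ⟨T.toList, ⟨T.nodup_toList, N, fun τ => (hT τ).1⟩, ?_⟩
  simp only [hT]
  exact basicUnion_basicClopen_of_length N fun τ => ∃ σ, W σ ∧ σ <+: τ

theorem lt_measureReal_basicUnion_basicClopen_iff (W : List Bool → Prop)
    (μ : Measure (ℕ → Bool)) [IsFiniteMeasure μ] {r : ℝ} (hr : 0 ≤ r) :
    r < μ.real (basicUnion basicClopen W) ↔
      ∃ T, IsExtensionList W T ∧ r < (T.map fun τ => μ.real (basicClopen τ)).sum := by
  refine ⟨fun h => ?_, fun ⟨T, hT, h⟩ => ?_⟩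
  · have hunion : basicUnion basicClopen W =
        ⋃ N, basicUnion basicClopen fun σ => σ.length ≤ N ∧ W σ := by
      rw [← basicUnion_exists]
      congr! 2 with σ
      exact ⟨fun hσ => ⟨_, le_rfl, hσ⟩, fun ⟨_, _, hσ⟩ => hσ⟩
    have hmono : Monotone fun N => basicUnion basicClopen fun σ => σ.length ≤ N ∧ W σ :=
      fun _ _ hNM _ ⟨σ, ⟨hσN, hσ⟩, hx⟩ => ⟨σ, ⟨hσN.trans hNM, hσ⟩, hx⟩
    rw [hunion, lt_measureReal_iUnion_iff_of_directed hmono.directed_le hr] at h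
    obtain ⟨N, hN⟩ := h
    obtain ⟨T, hT, hunionT⟩ := exists_isExtensionList W N
    refine ⟨T, hT, ?_⟩
    rw [hT.sum_measureReal, hunionT]
    exact hN.trans_le (measureReal_mono fun x ⟨σ, ⟨hσN, hσ⟩, hx⟩ =>
      ⟨σ, hσ, (mem_basicClopen_iff_isPrefix hσN).1 hx⟩)
  · rw [hT.sum_measureReal] at h
    exact h.trans_le (measureReal_mono hT.basicUnion_subset)

variable {μ : Measure (ℕ → Bool)}

theorem LowerSemicomputable.measure_basicUnion_basicClopen [IsFiniteMeasure μ] {α : Type*}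
    [Primcodable α] (hμ : LowerSemicomputable fun σ => μ.real (basicClopen σ))
    {W : α × List Bool → Prop} (hW : REPred W) :
    LowerSemicomputable fun a => μ.real (basicUnion basicClopen fun σ => W (a, σ)) :=
  of_lt_iff (rePred_isExtensionList hW)
    ((hμ.list_sum fun _ => measureReal_nonneg).comp Computable.snd)
    fun _ _ hr => lt_measureReal_basicUnion_basicClopen_iff _ μ hr

theorem compl_basicClopen (σ : List Bool) :
    (basicClopen σ)ᶜ = basicUnion basicClopen fun τ => τ.length = σ.length ∧ τ ≠ σ := by
  rw [basicUnion_basicClopen_of_length]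
  ext x
  exact not_congr mem_basicClopen_iff

theorem isComputableMeasure_iff_lowerSemicomputable [IsProbabilityMeasure μ] :
    IsComputableMeasure μ ↔ LowerSemicomputable fun σ => μ.real (basicClopen σ) := by
  refine ⟨fun ⟨f, hf, h⟩ => .of_computable_approx hf h fun _ => measureReal_nonneg, fun hμ => ?_⟩
  have hne : REPred fun q : List Bool × List Bool => q.2.length = q.1.length ∧ q.2 ≠ q.1 :=
    rePred_of_primrecPred ((Primrec.eq.comp (Primrec.list_length.comp Primrec.snd)
      (Primrec.list_length.comp Primrec.fst)).and (Primrec.eq.comp Primrec.snd Primrec.fst).not)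
  have hcompl := hμ.measure_basicUnion_basicClopen hne
  simp only [← compl_basicClopen, probReal_compl_eq_one_sub (measurableSet_basicClopen _)]
    at hcompl
  exact hμ.exists_computable_approx hcompl (fun _ => measureReal_nonneg) fun _ =>
    measureReal_le_one

end CantorSpace

section LowerSemicomputableOn

variable {X C α : Type*} [Primcodable C] [Primcodable α] {B : C → Set X} {f : α → X → ℝ}

/-- A family of real-valued functions is lower semicomputable with respect to the basic open sets
`B` if the sets where they exceed a given nonnegative rational are uniformly effectively open. -/
def LowerSemicomputableOn (B : C → Set X) (f : α → X → ℝ) : Prop :=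
  ∃ V : (α × ℕ × ℕ) × C → Prop, REPred V ∧ ∀ q : α × ℕ × ℕ,
    {t | (q.2.1 : ℝ) / ((q.2.2 : ℝ) + 1) < f q.1 t} = basicUnion B fun c => V (q, c)

theorem LowerSemicomputableOn.exists_setOf_lt_eq_basicUnion (hf : LowerSemicomputableOn B f)
    {β : Type*} [Primcodable β] {g : β → α} {k d : β → ℕ} (hg : Computable g)
    (hk : Computable k) (hd : Computable d) (hpos : ∀ b, 0 < d b) :
    ∃ W : β × C → Prop, REPred W ∧
      ∀ b, {t | (k b : ℝ) / d b < f (g b) t} = basicUnion B fun c => W (b, c) := by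
  obtain ⟨V, hV, hfV⟩ := hf
  refine ⟨fun q => V ((g q.1, k q.1, d q.1 - 1), q.2), rePred_comp hV
    (((hg.comp Computable.fst).pair ((hk.comp Computable.fst).pair
      (Computable.pred.comp (hd.comp Computable.fst)))).pair Computable.snd), fun b => ?_⟩
  refine Eq.trans ?_ (hfV (g b, k b, d b - 1))
  simp [Nat.cast_pred (hpos b)]

theorem sum_ite_div_lt_eq_gridBelow {t : ℝ} (ht : t ≤ 1) {d : ℕ} (hd : 0 < d) :
    ∑ j ∈ Finset.range d, (if ((j + 1 : ℕ) : ℝ) / d < t then (1 : ℝ) else 0) = gridBelow t d := by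
  have hgrid : gridBelow t d ≤ d :=
    (Nat.sub_le _ _).trans (Nat.ceil_le.2 (mul_le_of_le_one_left (Nat.cast_nonneg d) ht))
  have hfilter : (Finset.range d).filter (fun j : ℕ => ((j + 1 : ℕ) : ℝ) / d < t) =
      Finset.range (gridBelow t d) := by
    ext j
    have := le_gridBelow_iff (t := t) (k := j + 1) hd
    simp only [Nat.succ_ne_zero, false_or] at this
    rw [Finset.mem_filter, ← this, Finset.mem_range, Finset.mem_range]
    lia
  rw [Finset.sum_boole, hfilter, Finset.card_range]

section Integral

variable [MeasurableSpace X] {ν : Measure X} [IsFiniteMeasure ν] {g : X → ℝ}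

theorem integral_gridBelow (hg : Measurable g) (h1 : ∀ t, g t ≤ 1) {d : ℕ} (hd : 0 < d) :
    ∫ t, (gridBelow (g t) d : ℝ) ∂ν =
      ∑ j ∈ Finset.range d, ν.real {t | ((j + 1 : ℕ) : ℝ) / d < g t} := by
  have hmeas (j : ℕ) : MeasurableSet {t | ((j + 1 : ℕ) : ℝ) / d < g t} :=
    measurableSet_lt measurable_const hg
  simp_rw [← integral_indicator_one (hmeas _)]
  rw [← integral_finsetSum _ fun j _ =>
    (integrable_const (1 : ℝ)).indicator (f := 1) (hmeas j)]
  simp only [← sum_ite_div_lt_eq_gridBelow (h1 _) hd, Set.indicator_apply, Set.mem_ofPred_eq,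
    Pi.one_apply]

theorem tendsto_integral_gridBelow_div (hg : Measurable g) (h0 : ∀ t, 0 ≤ g t)
    (h1 : ∀ t, g t ≤ 1) :
    Tendsto (fun n : ℕ => ∫ t, (gridBelow (g t) (n + 1) : ℝ) / (n + 1) ∂ν) atTop
      (𝓝 (∫ t, g t ∂ν)) := by
  refine tendsto_integral_of_dominated_convergence (fun _ => 1) (fun n => ?_)
    (integrable_const 1) (fun n => ae_of_all _ fun t => ?_)
    (ae_of_all _ fun t => tendsto_gridBelow_div (h0 t))
  · have hceil : Measurable fun t => ⌈g t * (n + 1 : ℕ)⌉₊ := Nat.measurable_ceil.comp (by fun_prop)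
    have hgrid : Measurable fun t => (gridBelow (g t) (n + 1) : ℝ) :=
      measurable_from_nat.comp hceil (g := fun k => ((k - 1 : ℕ) : ℝ))
    exact (hgrid.div_const _).aestronglyMeasurable
  · rw [Real.norm_of_nonneg (by positivity)]
    exact_mod_cast (gridBelow_div_le (h0 t) (n + 1)).trans (h1 t)

/-- The integral is approximated from below by layer sums. -/
theorem LowerSemicomputableOn.lowerSemicomputable_integral
    (hν : LowerSemicomputable fun L : List C => ν.real (basicUnion B (· ∈ L)))
    (hf : LowerSemicomputableOn B f) (hmeas : ∀ a, Measurable (f a)) (h0 : ∀ a t, 0 ≤ f a t)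
    (h1 : ∀ a t, f a t ≤ 1) : LowerSemicomputable fun a => ∫ t, f a t ∂ν := by
  obtain ⟨W, hW, hfW⟩ := hf.exists_setOf_lt_eq_basicUnion (β := α × ℕ × ℕ) Computable.fst
    (Computable.succ.comp (Computable.fst.comp Computable.snd))
    (Computable.succ.comp (Computable.snd.comp Computable.snd)) fun _ => Nat.succ_pos _
  have hlayer := hν.measure_basicUnion hW
  simp only [← hfW] at hlayer
  have hlist : Computable fun q : α × ℕ => (List.range (q.2 + 1)).map fun j => (q.1, j, q.2) :=
    (Primrec.list_map (Primrec.list_range.comp (Primrec.succ.comp Primrec.snd))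
      ((Primrec.fst.comp Primrec.fst).pair
        (Primrec.snd.pair (Primrec.snd.comp Primrec.fst))).to₂).to_comp
  have hsum := ((hlayer.list_sum fun _ => measureReal_nonneg).comp hlist).div_natCast
    (Computable.succ.comp Computable.snd) fun _ => Nat.succ_pos _
  have hgrid (a : α) (n : ℕ) : ∫ t, (gridBelow (f a t) (n + 1) : ℝ) / (n + 1) ∂ν =
      (((List.range (n + 1)).map fun j => (a, j, n)).map fun q : α × ℕ × ℕ =>
        ν.real {t | ((q.2.1 + 1 : ℕ) : ℝ) / (q.2.2 + 1 : ℕ) < f q.1 t}).sum / (n + 1 : ℕ) := by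
    rw [integral_div, integral_gridBelow (hmeas a) (h1 a) n.succ_pos, List.map_map,
      ← List.sum_toFinset _ List.nodup_range, List.toFinset_range]
    simp
  have hint (a : α) : Integrable (f a) ν := .of_bound (hmeas a).aestronglyMeasurable 1
    (ae_of_all _ fun t => by simpa [abs_of_nonneg (h0 a t)] using h1 a t)
  refine .of_tendsto hsum (fun a n => ?_) fun a => ?_
  · simp only [← hgrid]
    exact integral_mono_of_nonneg (ae_of_all _ fun t => by positivity) (hint a)
      (ae_of_all _ fun t => by exact_mod_cast gridBelow_div_le (h0 a t) (n + 1))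
  · simp only [← hgrid]
    exact tendsto_integral_gridBelow_div (hmeas a) (h0 a) (h1 a)

end Integral

end LowerSemicomputableOn

section Mixture

variable {X Y C C' : Type*} [MeasurableSpace X] [MeasurableSpace Y] [Primcodable C]
  [Primcodable C'] {B : C → Set X} {B' : C' → Set Y} {ν : Measure X} {κ : X → Measure Y}

theorem measure_lt_le_of_bind_le (hκ : Measurable κ) {U : Set Y} (hU : MeasurableSet U)
    {ε : ENNReal} (h0 : ε ≠ 0) (htop : ε ≠ ⊤) (h : ν.bind κ U ≤ ε * ε) :
    ν {t | ε < κ t U} ≤ ε := by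
  have hmarkov := mul_meas_ge_le_lintegral (μ := ν) ((Measure.measurable_coe hU).comp hκ) ε
  simp only [Function.comp_apply] at hmarkov
  rw [← Measure.bind_apply hU hκ.aemeasurable] at hmarkov
  exact (measure_mono fun t (ht : ε < κ t U) => ht.le).trans
    ((ENNReal.mul_le_mul_iff_right h0 htop).1 (hmarkov.trans h))

theorem mem_MLR_bind [∀ t, IsFiniteMeasure (κ t)] (hκ : Measurable κ)
    (hB' : ∀ c, MeasurableSet (B' c))
    (heff : ∀ W : ℕ × C' → Prop, REPred W →
      LowerSemicomputableOn B fun i t => (κ t).real (basicUnion B' fun c => W (i, c)))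
    {t : X} (ht : t ∈ MLR B ∅ ν) {y : Y} (hy : y ∈ MLR B' ∅ (κ t)) :
    y ∈ MLR B' ∅ (ν.bind κ) := by
  refine mem_MLR_empty_iff.2 fun W hW hμ => ?_
  have hdouble : Computable fun i : ℕ => 2 * i := Primrec.nat_double.to_comp
  obtain ⟨V, hV, hWV⟩ := (heff W hW).exists_setOf_lt_eq_basicUnion hdouble (Computable.const 1)
    (d := fun i => 2 ^ i) (primrec_nat_pow.to_comp.comp (Computable.const 2) Computable.id)
    fun _ => by positivity
  have hbad (i : ℕ) : basicUnion B (fun c => V (i, c)) =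
      {t | (2⁻¹ : ENNReal) ^ i < κ t (basicUnion B' fun c => W (2 * i, c))} := by
    rw [← hWV]
    ext s
    rw [Set.mem_ofPred_eq, Set.mem_ofPred_eq, measureReal_def,
      ← ENNReal.ofReal_lt_iff_lt_toReal (by positivity) (measure_ne_top _ _)]
    simp [ENNReal.ofReal_inv_of_pos, ENNReal.ofReal_pow, ENNReal.inv_pow]
  have hsmall (i : ℕ) : ν (basicUnion B fun c => V (i, c)) ≤ (2⁻¹ : ENNReal) ^ i := by
    rw [hbad]
    refine measure_lt_le_of_bind_le hκ (measurableSet_basicUnion hB' _) (by simp) (by simp) ?_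
    rw [← pow_add, ← two_mul]
    exact hμ (2 * i)
  have hfiber := eventually_notMem_of_mem_MLR ht hV (.of_forall hsmall)
  simp only [hbad, Set.mem_ofPred_eq, not_lt] at hfiber
  obtain ⟨i, hi⟩ := (eventually_notMem_of_mem_MLR hy
    (rePred_comp hW ((hdouble.comp Computable.fst).pair Computable.snd)) hfiber).exists
  exact ⟨2 * i, hi⟩

end Mixture

section Bernoulli

instance (p : unitInterval) : IsProbabilityMeasure (bernoulliMu p) := by
  unfold bernoulliMu; infer_instance

theorem bernoulliMu_real_basicClopen (p : unitInterval) (σ : List Bool) :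
    (bernoulliMu p).real (basicClopen σ) =
      (p : ℝ) ^ σ.count false * (1 - (p : ℝ)) ^ σ.count true := by
  have hpi : basicClopen σ = Set.pi (Finset.range σ.length) fun i => {σ.getD i false} := by
    ext x
    simp only [basicClopen, Set.mem_ofPred_eq, Set.mem_pi, Finset.coe_range, Set.mem_Iio,
      Set.mem_singleton_iff]
    exact forall₂_congr fun i h => by rw [List.getD_eq_getElem _ _ h]
  have hprod : (bernoulliMu p).real (basicClopen σ) =
      ∏ i ∈ Finset.range σ.length, (bernoulliMeasure false true p).real {σ.getD i false} := by
    rw [hpi, measureReal_def, bernoulliMu,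
      Measure.infinitePi_pi _ fun _ _ => measurableSet_singleton _, ENNReal.toReal_prod]
    rfl
  rw [hprod]
  clear hpi hprod
  induction σ with
  | nil => simp
  | cons b σ ih =>
    rw [List.length_cons, Finset.prod_range_succ']
    simp only [List.getD_cons_succ, List.getD_cons_zero, ih]
    cases b <;> simp <;> ring

theorem measurable_bernoulliMu : Measurable bernoulliMu := by
  refine .measure_of_isPiSystem_of_isProbabilityMeasure
    (S := squareCylinders fun _ : ℕ => {s : Set Bool | MeasurableSet s})
    generateFrom_squareCylinders.symm
    (isPiSystem_squareCylinders (fun _ => MeasurableSpace.isPiSystem_measurableSet) (by simp)) ?_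
  rintro _ ⟨s, t, ht, rfl⟩
  have hprod (p : unitInterval) : bernoulliMu p (Set.pi s t) =
      ∏ i ∈ s, bernoulliMeasure false true p (t i) :=
    Measure.infinitePi_pi _ fun i _ => ht i (Set.mem_univ i)
  simp only [hprod, bernoulliMeasure_def, Measure.add_apply, unitInterval.toNNReal]
  refine Finset.measurable_prod _ fun i _ => ?_
  have hp : Measurable fun p : unitInterval => (p : ℝ) := measurable_subtype_coe
  have hsymm : Measurable fun p : unitInterval => ((unitInterval.symm p : unitInterval) : ℝ) := by
    simpa using hp.const_sub 1
  exact ((hp.subtype_mk.coe_nnreal_ennreal).mul_const _).add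
    ((hsymm.subtype_mk.coe_nnreal_ennreal).mul_const _)

theorem measurableSet_ratBall (c : ℕ × ℕ × ℕ) : MeasurableSet (ratBall c) :=
  measurableSet_lt (by fun_prop) measurable_const

theorem natCast_sub_le_iff {a b : ℕ} {x : ℝ} (hx : 0 ≤ x) :
    ((a - b : ℕ) : ℝ) ≤ x ↔ (a : ℝ) ≤ x + b := by
  rcases le_total b a with h | h
  · rw [Nat.cast_sub h, sub_le_iff_le_add]
  · rw [Nat.sub_eq_zero_of_le h, Nat.cast_zero]
    have : (a : ℝ) ≤ b := by exact_mod_cast h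
    exact iff_of_true hx (by linarith)

/-- A rational lower bound, built from the endpoints of the ball coded by `c`, for the Bernoulli
measures of `⟦σ⟧` with parameter in that ball. Truncated subtraction cuts the ball off at `0` and
`1`. -/
noncomputable def ballWeight (c : ℕ × ℕ × ℕ) (σ : List Bool) : ℝ :=
  (((c.1 - c.2.1 : ℕ) : ℝ) / (c.2.2 + 1)) ^ σ.count false *
    (((c.2.2 + 1 - (c.1 + c.2.1) : ℕ) : ℝ) / (c.2.2 + 1)) ^ σ.count true

theorem ballWeight_nonneg (c : ℕ × ℕ × ℕ) (σ : List Bool) : 0 ≤ ballWeight c σ := by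
  unfold ballWeight; positivity

theorem mem_ratBall_iff {t : unitInterval} {a r d : ℕ} :
    t ∈ ratBall (a, r, d) ↔ |(t : ℝ) * (d + 1) - a| < r := by
  have hd : (0 : ℝ) < d + 1 := by positivity
  rw [ratBall, Set.mem_ofPred_eq, sub_div' hd.ne', abs_div, abs_of_pos hd,
    div_lt_div_iff_of_pos_right hd]

theorem ballWeight_le {c : ℕ × ℕ × ℕ} {t : unitInterval} (ht : t ∈ ratBall c) (σ : List Bool) :
    ballWeight c σ ≤ (bernoulliMu t).real (basicClopen σ) := by
  obtain ⟨a, r, d⟩ := c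
  obtain ⟨hleft, hright⟩ := abs_lt.1 (mem_ratBall_iff.1 ht)
  have hd : (0 : ℝ) < d + 1 := by positivity
  have hfalse : ((a - r : ℕ) : ℝ) / (d + 1) ≤ t := by
    rw [div_le_iff₀ hd, natCast_sub_le_iff (mul_nonneg t.2.1 hd.le)]
    linarith
  have htrue : ((d + 1 - (a + r) : ℕ) : ℝ) / (d + 1) ≤ 1 - t := by
    rw [div_le_iff₀ hd, natCast_sub_le_iff (mul_nonneg (sub_nonneg.2 t.2.2) hd.le)]
    push_cast
    linarith
  rw [bernoulliMu_real_basicClopen, ballWeight]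
  exact mul_le_mul (pow_le_pow_left₀ (by positivity) hfalse _)
    (pow_le_pow_left₀ (by positivity) htrue _) (by positivity) (pow_nonneg t.2.1 _)

theorem abs_mul_sub_floor_lt (t : unitInterval) (n : ℕ) :
    |(t : ℝ) * (n + 1) - ⌊(t : ℝ) * (n + 1)⌋₊| < 1 := by
  have hle := Nat.floor_le (mul_nonneg t.2.1 (by positivity : (0 : ℝ) ≤ n + 1))
  have hlt := Nat.lt_floor_add_one ((t : ℝ) * (n + 1))
  exact abs_lt.2 ⟨by linarith, by linarith⟩

theorem abs_natCast_sub_sub_le {a b : ℕ} {x C : ℝ} (hx : 0 ≤ x) (h : |(a : ℝ) - b - x| ≤ C) :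
    |((a - b : ℕ) : ℝ) - x| ≤ C := by
  rcases le_total b a with hba | hab
  · rwa [Nat.cast_sub hba]
  · have : (a : ℝ) ≤ b := by exact_mod_cast hab
    rw [Nat.sub_eq_zero_of_le hab, Nat.cast_zero]
    rw [abs_of_nonpos (by linarith)] at h ⊢
    linarith

theorem tendsto_ballWeight_floor (t : unitInterval) (σ : List Bool) :
    Tendsto (fun n : ℕ => ballWeight (⌊(t : ℝ) * (n + 1)⌋₊, 1, n) σ) atTop
      (𝓝 ((bernoulliMu t).real (basicClopen σ))) := by
  rw [bernoulliMu_real_basicClopen]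
  refine .mul (.pow (tendsto_div_succ_of_abs_sub_le (C := 2) fun n => ?_) _)
    (.pow (tendsto_div_succ_of_abs_sub_le (C := 2) fun n => ?_) _) <;>
  obtain ⟨hleft, hright⟩ := abs_lt.1 (abs_mul_sub_floor_lt t n)
  · refine abs_natCast_sub_sub_le (mul_nonneg t.2.1 (by positivity)) (abs_le.2 ?_)
    push_cast
    constructor <;> linarith
  · refine abs_natCast_sub_sub_le (mul_nonneg (sub_nonneg.2 t.2.2) (by positivity)) (abs_le.2 ?_)
    push_cast
    constructor <;> linarith

theorem lt_sum_bernoulliMu_real_iff (t : unitInterval) (T : List (List Bool)) (r : ℝ) :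
    r < (T.map fun τ => (bernoulliMu t).real (basicClopen τ)).sum ↔
      ∃ c, r < (T.map fun τ => ballWeight c τ).sum ∧ t ∈ ratBall c := by
  refine ⟨fun h => ?_, fun ⟨c, hc, ht⟩ =>
    hc.trans_le (List.sum_le_sum fun τ _ => ballWeight_le ht τ)⟩
  have hlim : Tendsto (fun n : ℕ =>
      (T.map fun τ => ballWeight (⌊(t : ℝ) * (n + 1)⌋₊, 1, n) τ).sum) atTop
      (𝓝 (T.map fun τ => (bernoulliMu t).real (basicClopen τ)).sum) :=
    tendsto_list_sum _ fun τ _ => tendsto_ballWeight_floor t τ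
  obtain ⟨n, hn⟩ := (hlim.eventually_const_lt h).exists
  exact ⟨_, hn, mem_ratBall_iff.2 (by simpa using abs_mul_sub_floor_lt t n)⟩

theorem lowerSemicomputable_ballWeight :
    LowerSemicomputable fun q : (ℕ × ℕ × ℕ) × List Bool => ballWeight q.1 q.2 := by
  have hd : Primrec fun q : (ℕ × ℕ × ℕ) × List Bool => q.1.2.2 + 1 :=
    Primrec.succ.comp (Primrec.snd.comp (Primrec.snd.comp Primrec.fst))
  have ha : Primrec fun q : (ℕ × ℕ × ℕ) × List Bool => q.1.1 := Primrec.fst.comp Primrec.fst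
  have hr : Primrec fun q : (ℕ × ℕ × ℕ) × List Bool => q.1.2.1 :=
    Primrec.fst.comp (Primrec.snd.comp Primrec.fst)
  have hcount (b : Bool) : Primrec fun q : (ℕ × ℕ × ℕ) × List Bool => q.2.count b :=
    primrec_list_count.comp Primrec.snd (Primrec.const b)
  have hnum : Primrec fun q : (ℕ × ℕ × ℕ) × List Bool =>
      (q.1.1 - q.1.2.1) ^ q.2.count false * (q.1.2.2 + 1 - (q.1.1 + q.1.2.1)) ^ q.2.count true :=
    Primrec.nat_mul.comp (primrec_nat_pow.comp (Primrec.nat_sub.comp ha hr) (hcount false))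
      (primrec_nat_pow.comp (Primrec.nat_sub.comp hd (Primrec.nat_add.comp ha hr)) (hcount true))
  have hden : Primrec fun q : (ℕ × ℕ × ℕ) × List Bool =>
      (q.1.2.2 + 1) ^ q.2.count false * (q.1.2.2 + 1) ^ q.2.count true :=
    Primrec.nat_mul.comp (primrec_nat_pow.comp hd (hcount false))
      (primrec_nat_pow.comp hd (hcount true))
  convert (LowerSemicomputable.natCast hnum.to_comp).div_natCast hden.to_comp
    fun _ => by positivity using 2 with q
  rw [ballWeight, div_pow, div_pow, div_mul_div_comm]
  push_cast
  rfl

theorem lowerSemicomputable_sum_ballWeight :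
    LowerSemicomputable fun q : (ℕ × ℕ × ℕ) × List (List Bool) =>
      (q.2.map fun τ => ballWeight q.1 τ).sum := by
  have hlist : Primrec fun q : (ℕ × ℕ × ℕ) × List (List Bool) => q.2.map fun τ => (q.1, τ) :=
    Primrec.list_map Primrec.snd ((Primrec.fst.comp Primrec.fst).pair Primrec.snd).to₂
  simpa only [List.map_map, Function.comp_def] using
    (lowerSemicomputable_ballWeight.list_sum fun _ => ballWeight_nonneg _ _).comp hlist.to_comp

theorem lowerSemicomputableOn_bernoulliMu {α : Type*} [Primcodable α] {W : α × List Bool → Prop}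
    (hW : REPred W) : LowerSemicomputableOn ratBall
      fun a t => (bernoulliMu t).real (basicUnion basicClopen fun σ => W (a, σ)) := by
  have hsum : REPred fun s : ((α × ℕ × ℕ) × (ℕ × ℕ × ℕ)) × List (List Bool) =>
      (s.1.1.2.1 : ℝ) / ((s.1.1.2.2 : ℝ) + 1) < (s.2.map fun τ => ballWeight s.1.2 τ).sum :=
    rePred_comp lowerSemicomputable_sum_ballWeight
      (((Primrec.snd.comp Primrec.fst).pair Primrec.snd).pair
        (Primrec.snd.comp (Primrec.fst.comp Primrec.fst))).to_comp
  have hext : REPred fun s : ((α × ℕ × ℕ) × (ℕ × ℕ × ℕ)) × List (List Bool) =>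
      IsExtensionList (fun σ => W (s.1.1.1, σ)) s.2 :=
    rePred_comp (rePred_isExtensionList hW)
      ((Primrec.fst.comp (Primrec.fst.comp Primrec.fst)).pair Primrec.snd).to_comp
  refine ⟨_, rePred_exists (rePred_and hext hsum), fun q => ?_⟩
  ext t
  rw [Set.mem_ofPred_eq, lt_measureReal_basicUnion_basicClopen_iff _ _ (by positivity)]
  simp only [lt_sum_bernoulliMu_real_iff, basicUnion, Set.mem_ofPred_eq]
  exact ⟨fun ⟨T, hT, c, hc, ht⟩ => ⟨c, ⟨T, hT, hc⟩, ht⟩,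
    fun ⟨c, ⟨T, hT, hc⟩, ht⟩ => ⟨T, hT, c, hc, ht⟩⟩

theorem LowerSemicomputable.bind_bernoulliMu {ν : Measure unitInterval} [IsFiniteMeasure ν]
    (hν : LowerSemicomputable fun L : List (ℕ × ℕ × ℕ) => ν.real (basicUnion ratBall (· ∈ L))) :
    LowerSemicomputable fun σ => (ν.bind bernoulliMu).real (basicClopen σ) := by
  have hmeas (s : Set (ℕ → Bool)) (hs : MeasurableSet s) : Measurable fun t => bernoulliMu t s :=
    (Measure.measurable_coe hs).comp measurable_bernoulliMu
  have heq : REPred fun q : List Bool × List Bool => q.2 = q.1 :=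
    rePred_of_primrecPred (Primrec.eq.comp Primrec.snd Primrec.fst)
  have hcyl := lowerSemicomputableOn_bernoulliMu heq
  simp only [basicUnion, exists_eq_left, Set.ofPred_mem_eq] at hcyl
  have hint := hcyl.lowerSemicomputable_integral hν
    (fun σ => (hmeas _ (measurableSet_basicClopen σ)).ennreal_toReal)
    (fun _ _ => measureReal_nonneg) fun _ _ => measureReal_le_one
  convert hint using 2 with σ
  rw [measureReal_def, Measure.bind_apply (measurableSet_basicClopen σ)
    measurable_bernoulliMu.aemeasurable, ← integral_toReal
    (hmeas _ (measurableSet_basicClopen σ)).aemeasurable (ae_of_all _ fun _ => measure_lt_top _ _)]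
  rfl

theorem IsProperReal.isProperSeq {p : unitInterval} (hp : IsProperReal p) {x : ℕ → Bool}
    (hx : x ∈ MLR basicClopen ∅ (bernoulliMu p)) : IsProperSeq x := by
  obtain ⟨ν, _, hν, hpν⟩ := hp
  have : IsProbabilityMeasure (ν.bind bernoulliMu) :=
    isProbabilityMeasure_bind measurable_bernoulliMu.aemeasurable
      (ae_of_all _ fun _ => inferInstance)
  exact ⟨ν.bind bernoulliMu, this,
    isComputableMeasure_iff_lowerSemicomputable.2 (LowerSemicomputable.bind_bernoulliMu hν),
    mem_MLR_bind measurable_bernoulliMu measurableSet_basicClopen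
      (fun _ hW => lowerSemicomputableOn_bernoulliMu hW) hpν hx⟩

end Bernoulli

section LawOfLargeNumbers

/-- The real-valued indicator of the symbol 0. -/
def zeroIndicator (b : Bool) : ℝ :=
  if b = false then 1 else 0

/-- The relative frequency of the symbol 0 in a string; it is `0` for the empty string. -/
noncomputable def zeroFrequency (σ : List Bool) : ℝ :=
  σ.count false / σ.length

theorem zeroIndicator_mem_Icc (b : Bool) : zeroIndicator b ∈ Set.Icc 0 1 := by
  cases b <;> simp [zeroIndicator]

theorem zeroFrequency_mem_Icc (σ : List Bool) : zeroFrequency σ ∈ Set.Icc 0 1 :=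
  ⟨by unfold zeroFrequency; positivity,
    div_le_one_of_le₀ (by exact_mod_cast List.count_le_length) (by positivity)⟩

theorem isPrimrecRat_zeroFrequency : IsPrimrecRat zeroFrequency := by
  have hcount : Primrec fun σ : List Bool => σ.count false :=
    primrec_list_count.comp Primrec.id (Primrec.const false)
  convert IsPrimrecRat.natCast_div hcount
    (Primrec.succ.comp (Primrec.pred.comp Primrec.list_length)) fun _ => Nat.succ_pos _ with σ
  cases σ with
  | nil => simp [zeroFrequency]
  | cons b σ => simp [zeroFrequency]

theorem zeroFrequency_initialSegment (x : ℕ → Bool) (n : ℕ) :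
    zeroFrequency (initialSegment x n) = (∑ i ∈ Finset.range n, zeroIndicator (x i)) / n := by
  rw [zeroFrequency, length_initialSegment]
  congr 1
  induction n with
  | zero => simp [initialSegment]
  | succ n ih =>
    rw [Finset.sum_range_succ, ← ih, initialSegment, List.range_succ, List.map_append,
      List.count_append, ← initialSegment]
    cases h : x n <;> simp [h, zeroIndicator]

theorem memLp_zeroIndicator (p : unitInterval) (i : ℕ) :
    MemLp (fun x : ℕ → Bool => zeroIndicator (x i)) 2 (bernoulliMu p) :=
  .of_bound ((measurable_of_countable zeroIndicator).comp
    (measurable_pi_apply i)).aestronglyMeasurable 1 (ae_of_all _ fun x => by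
      rw [Real.norm_of_nonneg (zeroIndicator_mem_Icc _).1]
      exact (zeroIndicator_mem_Icc _).2)

theorem iIndepFun_zeroIndicator (p : unitInterval) :
    iIndepFun (fun (i : ℕ) (x : ℕ → Bool) => zeroIndicator (x i)) (bernoulliMu p) :=
  iIndepFun_infinitePi (X := fun _ => zeroIndicator) fun _ => measurable_of_countable _

theorem integral_zeroIndicator (p : unitInterval) (i : ℕ) :
    ∫ x : ℕ → Bool, zeroIndicator (x i) ∂bernoulliMu p = p := by
  have hmap : (bernoulliMu p).map (· i) = bernoulliMeasure false true p :=
    Measure.infinitePi_map_eval _ i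
  rw [← integral_map (μ := bernoulliMu p) (φ := fun x : ℕ → Bool => x i)
    (measurable_pi_apply i).aemeasurable (measurable_of_countable _).aestronglyMeasurable, hmap,
    integral_bernoulliMeasure]
  simp [zeroIndicator]

theorem variance_sum_zeroIndicator_le (p : unitInterval) (n : ℕ) :
    Var[∑ i ∈ Finset.range n, fun x : ℕ → Bool => zeroIndicator (x i); bernoulliMu p] ≤ n / 4 := by
  rw [IndepFun.variance_sum (fun i _ => memLp_zeroIndicator p i)
    fun i _ j _ hij => (iIndepFun_zeroIndicator p).indepFun hij]
  calc ∑ i ∈ Finset.range n, Var[fun x : ℕ → Bool => zeroIndicator (x i); bernoulliMu p]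
      ≤ ∑ _i ∈ Finset.range n, ((1 - 0) / 2 : ℝ) ^ 2 := Finset.sum_le_sum fun i _ =>
        variance_le_sq_of_bounded (ae_of_all _ fun x => zeroIndicator_mem_Icc (x i))
          (memLp_zeroIndicator p i).aestronglyMeasurable.aemeasurable
    _ = n / 4 := by
      rw [Finset.sum_const, Finset.card_range, nsmul_eq_mul]
      ring

theorem bernoulliMu_le_abs_zeroFrequency_sub_le (p : unitInterval) {n : ℕ} (hn : 0 < n) {ε : ℝ}
    (hε : 0 < ε) : bernoulliMu p {x | ε ≤ |zeroFrequency (initialSegment x n) - p|} ≤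
      ENNReal.ofReal (1 / (4 * n * ε ^ 2)) := by
  have hn0 : (0 : ℝ) < n := by exact_mod_cast hn
  have hmean : ∫ x, (∑ i ∈ Finset.range n, fun x : ℕ → Bool => zeroIndicator (x i)) x
      ∂bernoulliMu p = n * p := by
    simp only [Finset.sum_apply]
    rw [integral_finsetSum _ fun i _ => (memLp_zeroIndicator p i).integrable one_le_two]
    simp [integral_zeroIndicator]
  have hchebyshev := meas_ge_le_variance_div_sq (memLp_finsetSum' (Finset.range n) fun i _ =>
    memLp_zeroIndicator p i) (mul_pos hε hn0)
  rw [hmean] at hchebyshev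
  simp only [Finset.sum_apply] at hchebyshev
  have hset (x : ℕ → Bool) : ε ≤ |zeroFrequency (initialSegment x n) - p| ↔
      ε * n ≤ |∑ i ∈ Finset.range n, zeroIndicator (x i) - n * p| := by
    rw [zeroFrequency_initialSegment, div_sub' hn0.ne', abs_div, abs_of_pos hn0, le_div_iff₀ hn0]
  simp only [hset]
  refine hchebyshev.trans (ENNReal.ofReal_le_ofReal ?_)
  calc _ ≤ (n : ℝ) / 4 / (ε * n) ^ 2 := by gcongr; exact variance_sum_zeroIndicator_le p n
    _ = 1 / (4 * n * ε ^ 2) := by field_simp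

theorem ofReal_one_div_two_pow (i : ℕ) :
    ENNReal.ofReal (1 / 2 ^ i) = (2⁻¹ : ENNReal) ^ i := by
  rw [one_div, ENNReal.ofReal_inv_of_pos (by positivity), ENNReal.ofReal_pow (by positivity),
    ENNReal.inv_pow, ENNReal.ofReal_ofNat]

theorem eventually_not_of_mem_MLR {μ : Measure (ℕ → Bool)} {x : ℕ → Bool}
    (hx : x ∈ MLR basicClopen ∅ μ) {n : ℕ → ℕ} (hn : Primrec n) {P : ℕ → List Bool → Prop}
    (hP : PrimrecRel P)
    (hμ : ∀ᶠ i in atTop, μ {y | P i (initialSegment y (n i))} ≤ ENNReal.ofReal (1 / 2 ^ i)) :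
    ∀ᶠ i in atTop, ¬P i (initialSegment x (n i)) := by
  have hW : REPred fun q : ℕ × List Bool => q.2.length = n q.1 ∧ P q.1 q.2 :=
    rePred_of_primrecPred ((Primrec.eq.comp (Primrec.list_length.comp Primrec.snd)
      (hn.comp Primrec.fst)).and (hP.comp Primrec.fst Primrec.snd))
  simpa only [basicUnion_basicClopen_of_length, Set.mem_ofPred_eq] using
    eventually_notMem_of_mem_MLR hx hW
      (by simpa only [basicUnion_basicClopen_of_length, ← ofReal_one_div_two_pow] using hμ)

/-- The length of the `k`-th initial segment in which zeros are counted. Its growth makes the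
deviations by `1 / 2 ^ (k + 2)` summable. -/
def sampleSize (k : ℕ) : ℕ :=
  8 ^ (k + 2)

theorem primrec_sampleSize : Primrec sampleSize :=
  primrec_nat_pow.comp (Primrec.const 8) (Primrec.succ.comp Primrec.succ)

theorem sampleSize_mono : Monotone sampleSize := fun _ _ h =>
  Nat.pow_le_pow_right (by norm_num) (by lia)

theorem sampleSize_pos (k : ℕ) : 0 < sampleSize k :=
  Nat.pow_pos (by norm_num)

/-- The frequency of zeros in the first `sampleSize k` symbols of a string. -/
noncomputable def sampleFrequency (σ : List Bool) (k : ℕ) : ℝ :=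
  zeroFrequency (σ.take (sampleSize k))

theorem sampleFrequency_initialSegment (x : ℕ → Bool) {k n : ℕ} (h : sampleSize k ≤ n) :
    sampleFrequency (initialSegment x n) k = zeroFrequency (initialSegment x (sampleSize k)) := by
  rw [sampleFrequency, take_initialSegment x h]

theorem isPrimrecRat_sampleFrequency :
    IsPrimrecRat fun q : List Bool × ℕ => sampleFrequency q.1 q.2 :=
  isPrimrecRat_zeroFrequency.comp
    (Primrec.list_take.comp (primrec_sampleSize.comp Primrec.snd) Primrec.fst)

theorem isPrimrecRat_one_div_two_pow : IsPrimrecRat fun k : ℕ => (1 : ℝ) / 2 ^ k := by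
  simpa using IsPrimrecRat.natCast_div (Primrec.const 1)
    (primrec_nat_pow.comp (Primrec.const 2) Primrec.id) fun k => Nat.two_pow_pos k

variable {p : unitInterval} {x : ℕ → Bool}

theorem bernoulliMu_le_abs_zeroFrequency_sub_succ_le (p : unitInterval) (j : ℕ) :
    bernoulliMu p {y | 1 / 2 ^ (j + 1) ≤ |zeroFrequency (initialSegment y (sampleSize (j + 1))) -
      zeroFrequency (initialSegment y (sampleSize j))|} ≤ ENNReal.ofReal (1 / 2 ^ j) := by
  have hhalf : (1 : ℝ) / 2 ^ (j + 1) = 1 / 2 ^ (j + 2) + 1 / 2 ^ (j + 2) := by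
    rw [pow_succ _ (j + 1)]; field_simp; norm_num
  have hdeviation (k : ℕ) (hk : j ≤ k) :
      bernoulliMu p {y | 1 / 2 ^ (j + 2) ≤ |zeroFrequency (initialSegment y (sampleSize k)) - p|} ≤
        ENNReal.ofReal (1 / 2 ^ (j + 1)) := by
    refine (bernoulliMu_le_abs_zeroFrequency_sub_le p (sampleSize_pos k) (by positivity)).trans
      (ENNReal.ofReal_le_ofReal ?_)
    have hpow : (8 : ℝ) ^ (j + 2) = 2 ^ (j + 2) * 2 ^ (j + 2) * 2 ^ (j + 2) := by
      rw [← mul_pow, ← mul_pow]; norm_num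
    calc (1 : ℝ) / (4 * sampleSize k * (1 / 2 ^ (j + 2)) ^ 2)
        ≤ 1 / (4 * (8 : ℝ) ^ (j + 2) * (1 / 2 ^ (j + 2)) ^ 2) := by
          gcongr; exact_mod_cast sampleSize_mono hk
      _ = 1 / 2 ^ (j + 4) := by rw [hpow, pow_add _ j 4, pow_add _ j 2]; field_simp; norm_num
      _ ≤ 1 / 2 ^ (j + 1) := one_div_pow_le_one_div_pow_of_le one_le_two (by lia)
  refine (measure_mono fun y hy => ?_).trans <|
    (measure_union_le _ _).trans <|
      (add_le_add (hdeviation (j + 1) (by lia)) (hdeviation j le_rfl)).trans_eq ?_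
  · by_contra! h
    simp only [Set.mem_union, Set.mem_ofPred_eq, not_or, not_le] at hy h
    have := abs_sub_le (zeroFrequency (initialSegment y (sampleSize (j + 1)))) p
      (zeroFrequency (initialSegment y (sampleSize j)))
    rw [abs_sub_comm (p : ℝ)] at this
    linarith [h.1, h.2]
  · rw [← ENNReal.ofReal_add (by positivity) (by positivity), pow_succ]
    congr 1
    field_simp
    norm_num

theorem eventually_abs_zeroFrequency_sub_succ_lt (hx : x ∈ MLR basicClopen ∅ (bernoulliMu p)) :
    ∀ᶠ j in atTop, |zeroFrequency (initialSegment x (sampleSize (j + 1))) -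
      zeroFrequency (initialSegment x (sampleSize j))| < 1 / 2 ^ (j + 1) := by
  have hP : PrimrecRel fun (j : ℕ) (σ : List Bool) =>
      1 / 2 ^ (j + 1) ≤ |sampleFrequency σ (j + 1) - sampleFrequency σ j| :=
    (isPrimrecRat_one_div_two_pow.comp (Primrec.succ.comp Primrec.fst)).le
      ((isPrimrecRat_sampleFrequency.comp (Primrec.snd.pair (Primrec.succ.comp Primrec.fst))).sub
        (isPrimrecRat_sampleFrequency.comp (Primrec.snd.pair Primrec.fst))).abs
  have hsample (y : ℕ → Bool) (j : ℕ) := And.intro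
    (sampleFrequency_initialSegment y (le_refl (sampleSize (j + 1))))
    (sampleFrequency_initialSegment y (sampleSize_mono (Nat.le_add_right j 1)))
  simpa only [hsample, not_le] using
    eventually_not_of_mem_MLR hx (primrec_sampleSize.comp Primrec.succ) hP <| .of_forall fun j => by
      simpa only [hsample] using bernoulliMu_le_abs_zeroFrequency_sub_succ_le p j

theorem eventually_bernoulliMu_le_abs_zeroFrequency_sub_le (p : unitInterval) {ε : ℝ}
    (hε : 0 < ε) : ∀ᶠ k in atTop,
      bernoulliMu p {y | ε ≤ |zeroFrequency (initialSegment y (sampleSize k)) - p|} ≤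
        ENNReal.ofReal (1 / 2 ^ k) := by
  filter_upwards [(tendsto_pow_atTop_atTop_of_one_lt (one_lt_two (α := ℝ))).eventually_ge_atTop
    (1 / ε ^ 2)] with k hk
  refine (bernoulliMu_le_abs_zeroFrequency_sub_le p (sampleSize_pos k) hε).trans
    (ENNReal.ofReal_le_ofReal (one_div_le_one_div_of_le (by positivity) ?_))
  have hsize : 4 * (sampleSize k : ℝ) = 256 * (2 ^ k * 2 ^ k * 2 ^ k) := by
    rw [sampleSize, ← mul_pow, ← mul_pow]
    push_cast
    ring
  calc (2 : ℝ) ^ k ≤ 2 ^ k * (256 * 2 ^ k * (2 ^ k * ε ^ 2)) :=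
        le_mul_of_one_le_right (by positivity) <| one_le_mul_of_one_le_of_one_le
          (by linarith [one_le_pow₀ (one_le_two (α := ℝ)) (n := k)])
          ((div_le_iff₀ (by positivity)).1 hk)
    _ = 4 * sampleSize k * ε ^ 2 := by rw [hsize]; ring

-- The test compares the frequencies with a rational near `p`, because `p` itself is not available
-- to a test without oracle.
theorem eventually_abs_zeroFrequency_sub_lt (hx : x ∈ MLR basicClopen ∅ (bernoulliMu p)) (n : ℕ) :
    ∀ᶠ k in atTop, |zeroFrequency (initialSegment x (sampleSize k)) - p| < 3 / ((n : ℝ) + 1) := by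
  have hn : (0 : ℝ) < n + 1 := by positivity
  set q : ℝ := ⌊(p : ℝ) * (n + 1)⌋₊ / (n + 1) with hq
  have hpq : |(p : ℝ) - q| < 1 / (n + 1) := by
    rw [hq, sub_div' hn.ne', abs_div, abs_of_pos hn, div_lt_div_iff_of_pos_right hn]
    exact abs_mul_sub_floor_lt p n
  have hfrac (a : ℕ) : IsPrimrecRat fun _ : ℕ × List Bool => (a : ℝ) / (n + 1) := by
    simpa using IsPrimrecRat.natCast_div (Primrec.const a) (Primrec.const (n + 1))
      fun _ : ℕ × List Bool => n.succ_pos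
  have hP : PrimrecRel fun (k : ℕ) (σ : List Bool) =>
      ((2 : ℕ) : ℝ) / (n + 1) ≤ |sampleFrequency σ k - q| :=
    (hfrac 2).le ((isPrimrecRat_sampleFrequency.comp (Primrec.snd.pair Primrec.fst)).sub
      (hfrac _)).abs
  have htwo : ((2 : ℕ) : ℝ) / (n + 1) = 1 / (n + 1) + 1 / (n + 1) := by ring
  have hthree : (3 : ℝ) / (n + 1) = 1 / (n + 1) + 1 / (n + 1) + 1 / (n + 1) := by ring
  have hμ := eventually_bernoulliMu_le_abs_zeroFrequency_sub_le p (one_div_pos.2 hn)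
  have hrandom := eventually_not_of_mem_MLR hx primrec_sampleSize hP <| hμ.mono fun k hk => by
    refine (measure_mono fun y hy => ?_).trans hk
    simp only [Set.mem_ofPred_eq, sampleFrequency_initialSegment y le_rfl] at hy ⊢
    linarith [abs_sub_le (zeroFrequency (initialSegment y (sampleSize k))) p q]
  filter_upwards [hrandom] with k hk
  rw [sampleFrequency_initialSegment x le_rfl, not_le] at hk
  have := abs_sub_le (zeroFrequency (initialSegment x (sampleSize k))) q p
  rw [abs_sub_comm q] at this
  linarith

theorem tendsto_zeroFrequency_of_mem_MLR (hx : x ∈ MLR basicClopen ∅ (bernoulliMu p)) :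
    Tendsto (fun k => zeroFrequency (initialSegment x (sampleSize k))) atTop (𝓝 (p : ℝ)) := by
  refine Metric.tendsto_nhds.2 fun ε hε => ?_
  obtain ⟨n, hn⟩ := exists_nat_one_div_lt (show 0 < ε / 3 by positivity)
  filter_upwards [eventually_abs_zeroFrequency_sub_lt hx n] with k hk
  rw [Real.dist_eq]
  have : (3 : ℝ) / (n + 1) = 3 * (1 / (n + 1)) := by ring
  linarith

end LawOfLargeNumbers

section DampedLimit

/-- The index of the last accepted term of `a` among `a K, …, a (K + k)`: the term `a K` is
accepted, and `a (j + 1)` is accepted if it is within `1 / 2 ^ (j + 1)` of the last accepted term.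
The accepted terms converge at a known rate whether or not `a` converges. -/
noncomputable def dampIndex (K : ℕ) (a : ℕ → ℝ) : ℕ → ℕ
  | 0 => K
  | k + 1 => if |a (K + k + 1) - a (dampIndex K a k)| < 1 / 2 ^ (K + k + 1) then K + k + 1
      else dampIndex K a k

variable {K : ℕ} {a : ℕ → ℝ}

theorem dampIndex_le (k : ℕ) : dampIndex K a k ≤ K + k := by
  induction k with
  | zero => exact le_rfl
  | succ k ih =>
    rw [dampIndex]
    split_ifs <;> lia

theorem dampIndex_congr {a' : ℕ → ℝ} {k : ℕ} (h : ∀ j ≤ K + k, a j = a' j) :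
    dampIndex K a k = dampIndex K a' k := by
  induction k with
  | zero => rfl
  | succ k ih =>
    have hle : dampIndex K a k ≤ K + (k + 1) := (dampIndex_le k).trans (by lia)
    have hindex := ih fun j hj => h j (by lia)
    rw [dampIndex, dampIndex, h _ hle, hindex, h (K + k + 1) (by lia)]

theorem dampIndex_eq (h : ∀ j ≥ K, |a (j + 1) - a j| < 1 / 2 ^ (j + 1)) (k : ℕ) :
    dampIndex K a k = K + k := by
  induction k with
  | zero => rfl
  | succ k ih => rw [dampIndex, ih, if_pos (h _ (by lia)), add_assoc]

theorem dist_dampIndex_succ_le (K : ℕ) (a : ℕ → ℝ) (k : ℕ) :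
    dist (a (dampIndex K a k)) (a (dampIndex K a (k + 1))) ≤ 1 / 2 ^ K / 2 / 2 ^ k := by
  rw [dampIndex]
  split_ifs with h
  · rw [dist_comm, Real.dist_eq]
    refine h.le.trans_eq ?_
    rw [pow_succ, pow_add]
    field_simp
  · rw [dist_self]
    positivity

/-- The limit of the accepted terms of `a`. -/
noncomputable def dampLimit (K : ℕ) (a : ℕ → ℝ) : ℝ :=
  limUnder atTop fun k => a (dampIndex K a k)

theorem tendsto_dampLimit (K : ℕ) (a : ℕ → ℝ) :
    Tendsto (fun k => a (dampIndex K a k)) atTop (𝓝 (dampLimit K a)) :=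
  (cauchySeq_of_le_geometric_two (dist_dampIndex_succ_le K a)).tendsto_limUnder

theorem abs_dampIndex_sub_dampLimit_le (K : ℕ) (a : ℕ → ℝ) (k : ℕ) :
    |a (dampIndex K a k) - dampLimit K a| ≤ 1 / 2 ^ k := by
  have h := dist_le_of_le_geometric_two_of_tendsto (dist_dampIndex_succ_le K a)
    (tendsto_dampLimit K a) k
  rw [Real.dist_eq] at h
  exact h.trans (by gcongr; exact div_le_self zero_le_one (one_le_pow₀ one_le_two))

theorem dampLimit_mem_Icc (K : ℕ) (ha : ∀ j, a j ∈ Set.Icc 0 1) :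
    dampLimit K a ∈ Set.Icc 0 1 :=
  isClosed_Icc.mem_of_tendsto (tendsto_dampLimit K a) (.of_forall fun _ => ha _)

theorem dampLimit_eq (h : ∀ j ≥ K, |a (j + 1) - a j| < 1 / 2 ^ (j + 1)) {l : ℝ}
    (ha : Tendsto a atTop (𝓝 l)) : dampLimit K a = l := by
  refine tendsto_nhds_unique (tendsto_dampLimit K a) ?_
  simp only [dampIndex_eq h, add_comm K]
  exact ha.comp (tendsto_add_atTop_nat K)

theorem primrec_dampIndex {α : Type*} [Primcodable α] (K : ℕ) {a : α → ℕ → ℝ}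
    (ha : IsPrimrecRat fun q : α × ℕ => a q.1 q.2) :
    Primrec fun q : α × ℕ => dampIndex K (a q.1) q.2 := by
  have hnext : Primrec fun s : (α × ℕ) × (ℕ × ℕ) => K + s.2.1 + 1 :=
    Primrec.succ.comp (Primrec.nat_add.comp (Primrec.const K) (Primrec.fst.comp Primrec.snd))
  have hlast : Primrec fun s : (α × ℕ) × (ℕ × ℕ) => s.2.2 := Primrec.snd.comp Primrec.snd
  have hparam : Primrec fun s : (α × ℕ) × (ℕ × ℕ) => s.1.1 := Primrec.fst.comp Primrec.fst
  have haccept : PrimrecPred fun s : (α × ℕ) × (ℕ × ℕ) =>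
      |a s.1.1 (K + s.2.1 + 1) - a s.1.1 s.2.2| < 1 / 2 ^ (K + s.2.1 + 1) :=
    ((ha.comp (hparam.pair hnext)).sub (ha.comp (hparam.pair hlast))).abs.lt
      (isPrimrecRat_one_div_two_pow.comp hnext)
  refine (Primrec.nat_rec' Primrec.snd (Primrec.const K)
    (Primrec.ite haccept hnext hlast).to₂).of_eq fun q => ?_
  induction q.2 with
  | zero => rfl
  | succ k ih => rw [dampIndex, ← ih]

end DampedLimit

section FrequencyLimit

-- Otherwise unification evaluates the powers of `8`.
attribute [local irreducible] sampleSize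

theorem measurable_of_approx {Φ : (ℕ → Bool) → unitInterval} {n : ℕ → ℕ} {f : List Bool → ℕ → ℝ}
    (h : ∀ x k, |f (initialSegment x (n k)) k - Φ x| ≤ 1 / 2 ^ k) : Measurable Φ := by
  have hlim (x : ℕ → Bool) :
      Tendsto (fun k => f (initialSegment x (n k)) k) atTop (𝓝 (Φ x : ℝ)) := by
    refine tendsto_iff_dist_tendsto_zero.2 (squeeze_zero (fun _ => dist_nonneg) (h x) ?_)
    simpa only [one_div_pow] using
      tendsto_pow_atTop_nhds_zero_of_lt_one (r := (1 / 2 : ℝ)) (by norm_num) (by norm_num)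
  exact Measurable.subtype_mk (measurable_of_tendsto_metrizable
    (fun k => measurable_comp_initialSegment (f · k) (n k)) (tendsto_pi_nhds.2 hlim))

theorem lt_iff_exists_lt_sub_one_div_two_pow {y z r : ℝ} {f : ℕ → ℝ}
    (h : ∀ k, |f k - y| ≤ 1 / 2 ^ k) : |y - z| < r ↔ ∃ k, |f k - z| < r - 1 / 2 ^ k := by
  refine ⟨fun hy => ?_, fun ⟨k, hk⟩ => ?_⟩
  · obtain ⟨k, hk⟩ := exists_pow_lt_of_lt_one (half_pos (sub_pos.2 hy)) (one_half_lt_one (α := ℝ))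
    rw [one_div_pow] at hk
    exact ⟨k, by linarith [abs_sub_le (f k) y z, h k]⟩
  · linarith [abs_sub_le y (f k) z, abs_sub_comm y (f k), h k]

theorem effectivelyContinuous_of_approx {Φ : (ℕ → Bool) → unitInterval} {n : ℕ → ℕ}
    (hn : Primrec n) {f : List Bool → ℕ → ℝ}
    (hf : IsPrimrecRat fun q : List Bool × ℕ => f q.1 q.2)
    (h : ∀ x k, |f (initialSegment x (n k)) k - Φ x| ≤ 1 / 2 ^ k) :
    EffectivelyContinuous basicClopen ratBall Φ := by
  have hfrac {u : ℕ × ℕ × ℕ → ℕ} (hu : Primrec u) :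
      IsPrimrecRat fun s : ((ℕ × ℕ × ℕ) × List Bool) × ℕ => (u s.1.1 : ℝ) / (s.1.1.2.2 + 1) := by
    simpa using (IsPrimrecRat.natCast_div hu (Primrec.succ.comp (Primrec.snd.comp Primrec.snd))
      fun c : ℕ × ℕ × ℕ => c.2.2.succ_pos).comp (Primrec.fst.comp Primrec.fst)
  have hV : REPred fun s : ((ℕ × ℕ × ℕ) × List Bool) × ℕ => s.1.2.length = n s.2 ∧
      |f s.1.2 s.2 - s.1.1.1 / (s.1.1.2.2 + 1)| < s.1.1.2.1 / (s.1.1.2.2 + 1) - 1 / 2 ^ s.2 :=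
    rePred_of_primrecPred ((Primrec.eq.comp
      (Primrec.list_length.comp (Primrec.snd.comp Primrec.fst)) (hn.comp Primrec.snd)).and
      (((hf.comp ((Primrec.snd.comp Primrec.fst).pair Primrec.snd)).sub (hfrac Primrec.fst)).abs.lt
        ((hfrac (Primrec.fst.comp Primrec.snd)).sub
          (isPrimrecRat_one_div_two_pow.comp Primrec.snd))))
  refine ⟨_, rePred_exists hV, fun c => ?_⟩
  ext x
  rw [Set.mem_preimage, ratBall, Set.mem_ofPred_eq, lt_iff_exists_lt_sub_one_div_two_pow (h x)]
  refine ⟨fun ⟨k, hk⟩ => ⟨initialSegment x (n k), ⟨k, length_initialSegment x _, hk⟩,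
    by simp [mem_basicClopen_iff]⟩, ?_⟩
  rintro ⟨σ, ⟨k, hσ, hk⟩, hx⟩
  rw [mem_basicClopen_iff] at hx
  exact ⟨k, by rwa [← hσ, hx]⟩

/-- The frequency of zeros in `x` along the sample sizes, forced to converge by accepting only
those samples, from the `K`-th on, that are close to the previous accepted one. -/
noncomputable def frequencyLimit (K : ℕ) (x : ℕ → Bool) : unitInterval :=
  ⟨dampLimit K (zeroFrequency <| initialSegment x <| sampleSize ·),
    dampLimit_mem_Icc K fun _ => zeroFrequency_mem_Icc _⟩

/-- The approximation to `frequencyLimit K` read off a finite string. -/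
noncomputable def frequencyApprox (K : ℕ) (σ : List Bool) (k : ℕ) : ℝ :=
  sampleFrequency σ (dampIndex K (sampleFrequency σ) k)

theorem isPrimrecRat_frequencyApprox (K : ℕ) :
    IsPrimrecRat fun q : List Bool × ℕ => frequencyApprox K q.1 q.2 :=
  isPrimrecRat_sampleFrequency.comp
    (Primrec.fst.pair (primrec_dampIndex K isPrimrecRat_sampleFrequency))

theorem abs_frequencyApprox_sub_le (K : ℕ) (x : ℕ → Bool) (k : ℕ) :
    |frequencyApprox K (initialSegment x (sampleSize (K + k))) k - frequencyLimit K x| ≤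
      1 / 2 ^ k := by
  have hsample (j : ℕ) (hj : j ≤ K + k) :=
    sampleFrequency_initialSegment x (sampleSize_mono hj)
  rw [frequencyApprox, dampIndex_congr hsample, hsample _ (dampIndex_le k)]
  exact abs_dampIndex_sub_dampLimit_le K (zeroFrequency <| initialSegment x <| sampleSize ·) k

theorem measurable_frequencyLimit (K : ℕ) : Measurable (frequencyLimit K) :=
  measurable_of_approx (abs_frequencyApprox_sub_le K)

theorem effectivelyContinuous_frequencyLimit (K : ℕ) :
    EffectivelyContinuous basicClopen ratBall (frequencyLimit K) :=
  effectivelyContinuous_of_approx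
    (primrec_sampleSize.comp (Primrec.nat_add.comp (Primrec.const K) Primrec.id))
    (isPrimrecRat_frequencyApprox K) (abs_frequencyApprox_sub_le K)

theorem exists_frequencyLimit_eq {p : unitInterval} {x : ℕ → Bool}
    (hx : x ∈ MLR basicClopen ∅ (bernoulliMu p)) : ∃ K, frequencyLimit K x = p := by
  obtain ⟨K, hK⟩ := eventually_atTop.1 (eventually_abs_zeroFrequency_sub_succ_lt hx)
  exact ⟨K, Subtype.ext (dampLimit_eq hK (tendsto_zeroFrequency_of_mem_MLR hx))⟩

theorem IsComputableMeasure.map {μ : Measure (ℕ → Bool)} [IsProbabilityMeasure μ]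
    (hμ : IsComputableMeasure μ) {Φ : (ℕ → Bool) → unitInterval}
    (hΦ : EffectivelyContinuous basicClopen ratBall Φ) (hmeas : Measurable Φ) :
    IsComputableMeasureUnit (μ.map Φ) := by
  have hmem : REPred fun q : List (ℕ × ℕ × ℕ) × (ℕ × ℕ × ℕ) => q.2 ∈ q.1 := by
    refine rePred_of_primrecPred (PrimrecPred.of_eq
      (PrimrecRel.comp (PrimrecRel.exists_mem_list (Primrec.eq (α := ℕ × ℕ × ℕ)))
        Primrec.fst Primrec.snd) fun q => by simp)
  obtain ⟨W, hW, hpre⟩ := hΦ.exists_preimage_basicUnion_eq hmem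
  have hlsc : LowerSemicomputable fun L : List (ℕ × ℕ × ℕ) =>
      (μ.map Φ).real (basicUnion ratBall (· ∈ L)) := by
    simp only [map_measureReal_apply hmeas (measurableSet_basicUnion measurableSet_ratBall _), hpre]
    exact (isComputableMeasure_iff_lowerSemicomputable.1 hμ).measure_basicUnion_basicClopen hW
  exact hlsc

theorem IsProperSeq.isProperReal {p : unitInterval} {x : ℕ → Bool} (h : IsProperSeq x)
    (hx : x ∈ MLR basicClopen ∅ (bernoulliMu p)) : IsProperReal p := by
  obtain ⟨μ, _, hμ, hxμ⟩ := h
  obtain ⟨K, rfl⟩ := exists_frequencyLimit_eq hx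
  have hcont := effectivelyContinuous_frequencyLimit K
  have hmeas := measurable_frequencyLimit K
  exact ⟨μ.map (frequencyLimit K), Measure.isProbabilityMeasure_map hmeas.aemeasurable,
    hμ.map hcont hmeas, hcont.mem_MLR_map hmeas measurableSet_ratBall hxμ⟩

end FrequencyLimit

end AlgRandom

theorem corollary3p6_general (p : unitInterval) (x : ℕ → Bool)
    (hx : x ∈ AlgRandom.MLR AlgRandom.basicClopen ∅ (AlgRandom.bernoulliMu p)) :
    AlgRandom.IsProperSeq x ↔ AlgRandom.IsProperReal p :=
  ⟨fun h => h.isProperReal hx, fun h => h.isProperSeq hx⟩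

theorem corollary3p6 (p : unitInterval) (x : ℕ → Bool) (hx : x ∈ AlgRandom.bernoulliMLR p) :
    AlgRandom.IsProperSeq x ↔ AlgRandom.IsProperReal p :=
  corollary3p6_general p x (AlgRandom.MLR_subset_MLR_empty _ _ hx)
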